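/- All manifolds are smooth, Hausdorff and second countable (except that spaces of arrows of Lie groupoids need not be Hausdorff or second countable), submanifolds are embedded, and connected means connected and non-empty. **Orbifolds.** Let $X$ be a second countable Hausdorff space. An $n$-dimensional orbifold chart $(U,\widetilde U/\Gamma,\pi)$ on $X$ consists of an open set $U\subset X$, a connected $n$-manifold $\widetilde U$, a finite group $\Gamma$ acting smoothly and effectively on $\widetilde U$, and a continuous $\Gamma$-invariant map $\pi:\widetilde U\to U$ that induces a homeomorphism $\widetilde U/\Gamma\to U$. An injection between two charts is a smooth embedding $\lambda:\widetilde U_1\to\widetilde U_2$ with $\pi_2\circ\lambda=\pi_1$. Two charts are compatible if every $x\in U_1\cap U_2$ lies in the domain $W\subset U_1\cap U_2$ of a chart that admits injections into both. An atlas is a collection of pairwise compatible charts whose domains cover $X$, and an orbifold is a pair $(X,\mathcal A)$ with $\mathcal A$ a maximal atlas. A countable atlas $\mathcal A'\subset\mathcal A$ is a countable family $\{(U_i,\widetilde U_i/\Gamma_i,\pi_i)\}_{i\in I}$ of elements of $\mathcal A$ (repetitions allowed) whose domains cover $X$. **Suborbifold covers.** A $k$-dimensional suborbifold cover on $Y\subset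 X$ with respect to $\mathcal A'$ consists of a subset $J\subset I$ and, for every $j\in J$, a connected $k$-dimensional submanifold $\widetilde V_j\subset\widetilde U_j$ and a subgroup $\Delta_j\subset\Gamma_j$ leaving $\widetilde V_j$ invariant, such that any two points of $\widetilde V_j$ in the same $\Gamma_j$-orbit are in the same $\Delta_j$-orbit, $\pi_j(\widetilde V_j)$ is open in $Y$, and $\bigcup_j\pi_j(\widetilde V_j)=Y$. It is closed if every $\widetilde V_j$ is closed in $\widetilde U_j$. Let $K_j$ be the kernel of the action of $\Delta_j$ on $\widetilde V_j$. The cover is said to induce charts if, for every $j$, $\pi_j$ induces a homeomorphism $\widetilde V_j/\Delta_j\to\pi_j(\widetilde V_j)$; every closed cover induces charts. In this case the family $\mathcal B=\{(\pi_j(\widetilde V_j),\widetilde V_j/(\Delta_j/K_j),\pi_j|_{\widetilde V_j})\}_{j\in J}$ is the induced orbifold atlas on $Y$. **Groupoids.** For a countable family $\mathcal C=\{(U_i,\widetilde U_i/\Gamma_i,\pi_i)\}_{i}$ of orbifold charts, $\mathcal G(\mathcal C)$ is the groupoid with objects $\coprod_i\widetilde U_i$ whose arrows are the germs $[f]_p:p\to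 f(p)$ of diffeomorphisms $f$ between open subsets of $\coprod_i\widetilde U_i$ with $\pi\circ f=\pi|_{\mathrm{dom} f}$, where $\pi=\coprod_i\pi_i$; composition is composition of germs, and the space of arrows has the topology and smooth structure for which each $p\mapsto[f]_p$ is a diffeomorphism from $\mathrm{dom} f$ onto an open set. Let $|\mathcal G(\mathcal C)|$ be its orbit space and let $\varepsilon_{\mathcal C}$ send the orbit of $p$ to $\pi(p)$. A groupoid embedding $\Phi=(\Phi_0,\Phi_1)$ is a functor whose components $\Phi_0$ on objects and $\Phi_1$ on arrows are smooth embeddings; $|\Phi|$ is the induced map of orbit spaces. **Strong suborbifolds.** A subset $Y\subset X$ is a $k$-dimensional strong suborbifold of $(X,\mathcal A)$ if there are a countable atlas $\mathcal A'\subset\mathcal A$, a closed $k$-dimensional suborbifold cover on $Y$ with respect to $\mathcal A'$ with induced atlas $\mathcal B$, and a groupoid embedding $\Phi:\mathcal G(\mathcal B)\to\mathcal G(\mathcal A')$ such that $\varepsilon_{\mathcal A'}\circ|\Phi|=\varepsilon_{\mathcal B}$ (as maps to $X$, via $Y\subset X$). **Proposition.** Let $(X,\mathcal A)$ be an $n$-dimensional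 orbifold, $k\ge 0$ and $Y\subset X$. Then the following are equivalent: 1. $Y$ is a $k$-dimensional strong suborbifold of $(X,\mathcal A)$; 2. there are a countable atlas $\mathcal A'\subset\mathcal A$, a $k$-dimensional suborbifold cover on $Y$ with respect to $\mathcal A'$ that induces charts (it need not be closed), with induced orbifold atlas $\mathcal B'$ on $Y$, and a groupoid embedding $\Phi':\mathcal G(\mathcal B')\to\mathcal G(\mathcal A')$ such that $\Phi'_0$ is the inclusion $\coprod_{j\in J}\widetilde V_j\hookrightarrow\coprod_{i\in I}\widetilde U_i$; 3. the same as 2, with a closed suborbifold cover. -/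

import Mathlib

open scoped Manifold ContDiff Topology
open Manifold (IsSmoothEmbedding)

universe u v w

noncomputable section

namespace Orb

/-! ### Disjoint unions of manifolds, and manifolds étale over a manifold -/

section Manifolds

variable {H : Type*} [TopologicalSpace H]

/-- The disjoint union of a family of manifolds: its charts are the charts of the pieces. -/
instance sigmaChartedSpace {ι : Type*} {M : ι → Type*} [Nonempty H]
    [∀ i, TopologicalSpace (M i)] [∀ i, ChartedSpace H (M i)] :
    ChartedSpace H (Σ i, M i) where
  atlas := {e | ∃ i, ∃ c ∈ atlas H (M i), e = c.lift_openEmbedding (.sigmaMk (i := i))}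
  chartAt p := (chartAt H p.2).lift_openEmbedding (.sigmaMk (i := p.1))
  mem_chart_source p := by
    rw [OpenPartialHomeomorph.lift_openEmbedding_source]
    exact ⟨p.2, mem_chart_source H p.2, rfl⟩
  chart_mem_atlas p := ⟨p.1, _, chart_mem_atlas H p.2, rfl⟩

instance sigmaIsManifold {E : Type*} [NormedAddCommGroup E] [NormedSpace ℝ E]
    {I : ModelWithCorners ℝ E H} {r : ℕ∞ω} {ι : Type*} {M : ι → Type*} [Nonempty H]
    [∀ i, TopologicalSpace (M i)] [∀ i, ChartedSpace H (M i)] [∀ i, IsManifold I r (M i)] :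
    IsManifold I r (Σ i, M i) where
  compatible {e e'} he he' := by
    obtain ⟨i, c, hc, rfl⟩ := he
    obtain ⟨i', c', hc', rfl⟩ := he'
    by_cases hii : i = i'
    · subst hii
      rw [c.lift_openEmbedding_trans c' .sigmaMk]
      exact (contDiffGroupoid r I).compatible hc hc'
    · apply ContDiffGroupoid.mem_of_source_eq_empty
      ext x
      refine ⟨fun ⟨_, hx⟩ => ?_, fun hx => hx.elim⟩
      obtain ⟨y, _, hy⟩ := hx
      exact hii (congrArg Sigma.fst hy).symm

/-- The smooth structure on `N` pulled back along a local homeomorphism `s : N → M` (the one that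
makes `s` a local diffeomorphism): its charts are the local inverses of `s` followed by the charts
of `M`. -/
@[reducible]
def etaleChartedSpace {M N : Type*} [TopologicalSpace M] [TopologicalSpace N] [ChartedSpace H M]
    {s : N → M} (hs : IsLocalHomeomorph s) : ChartedSpace H N where
  atlas := {e | ∃ φ : OpenPartialHomeomorph N M, (φ : N → M) = s ∧
    ∃ c ∈ atlas H M, e = φ.trans c}
  chartAt a := (hs a).choose.trans (chartAt H (s a))
  mem_chart_source a := by
    obtain ⟨h1, h2⟩ := (hs a).choose_spec
    rw [OpenPartialHomeomorph.trans_source]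
    refine ⟨h1, ?_⟩
    rw [Set.mem_preimage, ← h2]
    exact mem_chart_source H (s a)
  chart_mem_atlas a := ⟨_, (hs a).choose_spec.2.symm, _, chart_mem_atlas H (s a), rfl⟩

theorem etaleIsManifold {E : Type*} [NormedAddCommGroup E] [NormedSpace ℝ E]
    {I : ModelWithCorners ℝ E H} {r : ℕ∞ω} {M N : Type*} [TopologicalSpace M] [TopologicalSpace N]
    [ChartedSpace H M] [IsManifold I r M] {s : N → M} (hs : IsLocalHomeomorph s) :
    letI := etaleChartedSpace (H := H) hs
    IsManifold I r N := by
  let _ := etaleChartedSpace (H := H) hs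
  refine isManifold_of_contDiffOn I r N ?_
  rintro _ _ ⟨φ, hφ, c, hc, rfl⟩ ⟨ψ, hψ, d, hd, rfl⟩
  have hcd := ((mem_groupoid_of_pregroupoid.1 ((contDiffGroupoid r I).compatible hc hd))).1
  have key : ∀ z ∈ ((φ.trans c).symm.trans (ψ.trans d)).source,
      ψ (φ.symm (c.symm z)) = c.symm z := by
    intro z hz
    rw [hψ, ← hφ]
    exact φ.right_inv hz.1.2
  refine ContDiffOn.congr (hcd.mono ?_) ?_
  · rintro y ⟨hy, hyI⟩
    refine ⟨⟨hy.1.1, ?_⟩, hyI⟩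
    have h2 : ψ (φ.symm (c.symm (I.symm y))) ∈ d.source := hy.2.2
    rwa [key _ hy] at h2
  · rintro y ⟨hy, -⟩
    change I (d (ψ (φ.symm (c.symm (I.symm y))))) = I (d (c.symm (I.symm y)))
    rw [key _ hy]

end Manifolds

/-! ### The groupoid of germs of transitions over a map `π : M → X` -/

section Groupoid

variable (n : ℕ) {M : Type u} [TopologicalSpace M] [ChartedSpace (EuclideanSpace ℝ (Fin n)) M]
  {X : Type v} (π : M → X)

/-- `f` is a diffeomorphism between open subsets of `M` such that `π ∘ f = π` on its domain. -/
structure IsTransition (f : OpenPartialHomeomorph M M) : Prop where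
  contMDiffOn : ContMDiffOn (𝓡 n) (𝓡 n) ∞ f f.source
  contMDiffOn_symm : ContMDiffOn (𝓡 n) (𝓡 n) ∞ f.symm f.target
  proj_apply : ∀ p ∈ f.source, π (f p) = π p

variable {n π}

theorem IsTransition.refl : IsTransition n π (OpenPartialHomeomorph.refl M) where
  contMDiffOn := contMDiffOn_id
  contMDiffOn_symm := contMDiffOn_id
  proj_apply _ _ := rfl

theorem IsTransition.symm {f : OpenPartialHomeomorph M M} (hf : IsTransition n π f) :
    IsTransition n π f.symm where
  contMDiffOn := hf.contMDiffOn_symm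
  contMDiffOn_symm := hf.contMDiffOn
  proj_apply p hp := by
    have := hf.proj_apply (f.symm p) (f.map_target hp)
    rw [f.right_inv hp] at this
    exact this.symm

theorem IsTransition.trans {f g : OpenPartialHomeomorph M M} (hf : IsTransition n π f)
    (hg : IsTransition n π g) : IsTransition n π (f.trans g) where
  contMDiffOn := hg.contMDiffOn.comp (hf.contMDiffOn.mono fun _ h => h.1) fun _ h => h.2
  contMDiffOn_symm :=
    hf.contMDiffOn_symm.comp (hg.contMDiffOn_symm.mono fun _ h => h.1) fun _ h => h.2
  proj_apply p hp := (hg.proj_apply _ hp.2).trans (hf.proj_apply p hp.1)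

theorem IsTransition.restr {f : OpenPartialHomeomorph M M} (hf : IsTransition n π f)
    {s : Set M} (hs : IsOpen s) : IsTransition n π (f.restrOpen s hs) where
  contMDiffOn := hf.contMDiffOn.mono fun _ h => h.1
  contMDiffOn_symm := hf.contMDiffOn_symm.mono fun _ h => h.1
  proj_apply p hp := hf.proj_apply p hp.1

variable (n π)

/-- A transition together with a point of its domain. -/
structure PointedTransition where
  map : OpenPartialHomeomorph M M
  isTransition : IsTransition n π map
  pt : M
  pt_mem : pt ∈ map.source

/-- `(f, p)` and `(g, q)` define the same germ if `p = q` and `f = g` near `p`. -/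
instance germSetoid : Setoid (PointedTransition n π) where
  r x y := x.pt = y.pt ∧ x.map =ᶠ[𝓝 x.pt] y.map
  iseqv :=
    { refl := fun _ => ⟨rfl, .rfl⟩
      symm := fun h => ⟨h.1.symm, h.1 ▸ h.2.symm⟩
      trans := fun h h' => ⟨h.1.trans h'.1, h.2.trans (h.1 ▸ h'.2)⟩ }

/-- The arrows: germs `[f]_p` of transitions `f` at points `p` of their domains. -/
def Arrow : Type u := Quotient (germSetoid n π)

variable {n π}

namespace Arrow

/-- The germ `[f]_p`. -/
def mk (f : OpenPartialHomeomorph M M) (hf : IsTransition n π f) (p : M) (hp : p ∈ f.source) :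
    Arrow n π :=
  Quotient.mk _ ⟨f, hf, p, hp⟩

/-- The source `s([f]_p) = p`. -/
def src : Arrow n π → M :=
  Quotient.lift (fun x => x.pt) fun _ _ h => h.1

/-- The target `t([f]_p) = f(p)`. -/
def tgt : Arrow n π → M :=
  Quotient.lift (fun x => x.map x.pt) fun x y h => by
    have := h.2.eq_of_nhds
    rw [this, h.1]

/-- The unit `[id]_p`. -/
def unit (p : M) : Arrow n π :=
  mk (OpenPartialHomeomorph.refl M) .refl p (Set.mem_univ p)

/-- The inverse `[f⁻¹]_{f(p)}` of `[f]_p`. -/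
def inv : Arrow n π → Arrow n π :=
  Quotient.lift
    (fun x => mk x.map.symm x.isTransition.symm (x.map x.pt) (x.map.map_source x.pt_mem))
    fun x y h => by
      obtain ⟨f, hf, p, hp⟩ := x
      obtain ⟨g, hg, q, hq⟩ := y
      obtain ⟨rfl, h⟩ : p = q ∧ f =ᶠ[𝓝 p] g := h
      have hpq : f p = g p := h.eq_of_nhds
      refine Quotient.sound ⟨hpq, ?_⟩
      change f.symm =ᶠ[𝓝 (f p)] g.symm
      have h1 : ∀ᶠ y in 𝓝 (f p), f.symm y ∈ g.source :=
        (f.continuousAt_symm (f.map_source hp)).eventually_mem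
          (by rw [f.left_inv hp]; exact g.open_source.mem_nhds hq)
      have h2 : ∀ᶠ y in 𝓝 (f p), f (f.symm y) = g (f.symm y) := by
        have hc := f.continuousAt_symm (f.map_source hp)
        unfold ContinuousAt at hc
        rw [f.left_inv hp] at hc
        exact hc.eventually h
      have h3 : ∀ᶠ y in 𝓝 (f p), y ∈ f.target :=
        f.open_target.mem_nhds (f.map_source hp)
      filter_upwards [h1, h2, h3] with y h1 h2 h3
      rw [f.right_inv h3] at h2
      rw [h2, g.left_inv h1, ← h2]

/-- The composition `[g]_{f(p)} [f]_p = [g ∘ f]_p`. -/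
def comp (b a : Arrow n π) (h : b.src = a.tgt) : Arrow n π :=
  Quotient.hrecOn₂ b a
    (φ := fun b a : Quotient (germSetoid n π) => src b = tgt a → Arrow n π)
    (fun y x h => mk (x.map.trans y.map) (x.isTransition.trans y.isTransition) x.pt
      ⟨x.pt_mem, by
        have h : y.pt = x.map x.pt := h
        rw [Set.mem_preimage]
        exact h ▸ y.pt_mem⟩)
    (fun y x y' x' hy hx => by
      have e1 : src (Quotient.mk _ y) = src (Quotient.mk _ y') := congrArg src (Quotient.sound hy)
      have e2 : tgt (Quotient.mk _ x) = tgt (Quotient.mk _ x') := congrArg tgt (Quotient.sound hx)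
      refine Function.hfunext (by rw [e1, e2]) fun h h' _ => heq_of_eq ?_
      refine Quotient.sound ⟨hx.1, ?_⟩
      obtain ⟨f, hf, p, hp⟩ := x
      obtain ⟨f', hf', p', hp'⟩ := x'
      obtain ⟨g, hg, q, hq⟩ := y
      obtain ⟨g', hg', q', hq'⟩ := y'
      have h : q = f p := h
      obtain ⟨rfl, hy⟩ : q = q' ∧ g =ᶠ[𝓝 q] g' := hy
      obtain ⟨rfl, hx⟩ : p = p' ∧ f =ᶠ[𝓝 p] f' := hx
      have hc : Filter.Tendsto f (𝓝 p) (𝓝 q) := h ▸ f.continuousAt hp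
      change ⇑g ∘ ⇑f =ᶠ[𝓝 p] ⇑g' ∘ ⇑f'
      filter_upwards [hc.eventually hy, hx] with z h1 h2
      simp only [Function.comp_apply]
      rw [h1, h2])
    h

theorem src_unit (p : M) : (unit p : Arrow n π).src = p := rfl

theorem tgt_unit (p : M) : (unit p : Arrow n π).tgt = p := rfl

theorem src_inv (a : Arrow n π) : a.inv.src = a.tgt :=
  Quotient.inductionOn a fun _ => rfl

theorem tgt_inv (a : Arrow n π) : a.inv.tgt = a.src :=
  Quotient.inductionOn a fun x => x.map.left_inv x.pt_mem

theorem src_comp (b a : Arrow n π) (h : b.src = a.tgt) : (comp b a h).src = a.src := by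
  induction b, a using Quotient.inductionOn₂
  rfl

theorem tgt_comp (b a : Arrow n π) (h : b.src = a.tgt) : (comp b a h).tgt = b.tgt := by
  induction b, a using Quotient.inductionOn₂ with
  | h y x =>
    have h : y.pt = x.map x.pt := h
    change y.map (x.map x.pt) = y.map y.pt
    rw [h]

theorem proj_tgt (a : Arrow n π) : π a.tgt = π a.src :=
  Quotient.inductionOn a fun x => x.isTransition.proj_apply _ x.pt_mem

/-- The topology on the space of arrows, generated by the sets `{[f]_p | p ∈ dom f}`. -/
instance : TopologicalSpace (Arrow n π) :=
  .generateFrom {S | ∃ (f : OpenPartialHomeomorph M M) (hf : IsTransition n π f),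
    S = Set.range fun p : f.source => mk f hf p p.2}

theorem isOpen_range_mk (f : OpenPartialHomeomorph M M) (hf : IsTransition n π f) :
    IsOpen (Set.range fun p : f.source => mk f hf p p.2) :=
  .basic _ ⟨f, hf, rfl⟩

theorem continuous_mk (f : OpenPartialHomeomorph M M) (hf : IsTransition n π f) :
    Continuous fun p : f.source => mk f hf p p.2 := by
  refine continuous_generateFrom_iff.2 ?_
  rintro _ ⟨g, hg, rfl⟩
  have : (fun p : f.source => mk f hf p p.2) ⁻¹' Set.range (fun p : g.source => mk g hg p p.2) =
      (↑) ⁻¹' (g.source ∩ {p | f =ᶠ[𝓝 p] g}) := by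
    ext ⟨p, hp⟩
    constructor
    · rintro ⟨⟨q, hq⟩, h⟩
      obtain ⟨rfl, h'⟩ : q = p ∧ g =ᶠ[𝓝 q] f := Quotient.exact h
      exact ⟨hq, h'.symm⟩
    · rintro ⟨hq, h⟩
      exact ⟨⟨p, hq⟩, Quotient.sound ⟨rfl, Filter.EventuallyEq.symm h⟩⟩
  rw [this]
  exact (g.open_source.inter isOpen_setOfPred_eventually_nhds).preimage continuous_subtype_val

theorem continuous_src : Continuous (src : Arrow n π → M) := by
  refine continuous_iff_continuousAt.2 fun a => ?_
  induction a using Quotient.inductionOn with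
  | h x =>
    obtain ⟨f, hf, p, hp⟩ := x
    intro O hO
    obtain ⟨O', hO', hO'o, hpO⟩ := mem_nhds_iff.1 hO
    have hmem : (Quotient.mk _ ⟨f, hf, p, hp⟩ : Arrow n π) ∈
        Set.range fun q : (f.restrOpen O' hO'o).source => mk _ (hf.restr hO'o) q q.2 :=
      ⟨⟨p, hp, hpO⟩, Quotient.sound ⟨rfl, .rfl⟩⟩
    refine Filter.mem_map.2 <| Filter.mem_of_superset ((isOpen_range_mk _ (hf.restr hO'o)).mem_nhds hmem) ?_
    rintro _ ⟨⟨q, hq⟩, rfl⟩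
    exact hO' hq.2

/-- The source map is a local homeomorphism. -/
theorem isLocalHomeomorph_src : IsLocalHomeomorph (src : Arrow n π → M) := by
  refine isLocalHomeomorph_iff_isOpenEmbedding_restrict.2 fun a => ?_
  induction a using Quotient.inductionOn with
  | h x =>
    obtain ⟨f, hf, p, hp⟩ := x
    refine ⟨_, (isOpen_range_mk f hf).mem_nhds ⟨⟨p, hp⟩, rfl⟩, ?_⟩
    refine .of_continuous_injective_isOpenMap (continuous_src.comp continuous_subtype_val) ?_ ?_
    · rintro ⟨_, ⟨q, hq⟩, rfl⟩ ⟨_, ⟨r, hr⟩, rfl⟩ h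
      obtain rfl : q = r := h
      rfl
    · intro S hS
      have hopen := hS.preimage ((continuous_mk f hf).codRestrict
        (s := Set.range fun p : f.source => mk f hf p p.2) fun q => ⟨q, rfl⟩)
      convert f.open_source.isOpenMap_subtype_val _ hopen using 1
      ext q
      constructor
      · rintro ⟨⟨_, ⟨r, hr⟩, rfl⟩, hrS, rfl⟩
        exact ⟨⟨r, hr⟩, hrS, rfl⟩
      · rintro ⟨⟨r, hr⟩, hrS, rfl⟩
        exact ⟨⟨_, ⟨r, hr⟩, rfl⟩, hrS, rfl⟩

/-- The smooth structure on the space of arrows, for which every `p ↦ [f]_p` is a diffeomorphism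
from `dom f` onto its open image (equivalently, the source map is a local diffeomorphism). -/
instance : ChartedSpace (EuclideanSpace ℝ (Fin n)) (Arrow n π) :=
  etaleChartedSpace isLocalHomeomorph_src

instance [IsManifold (𝓡 n) ∞ M] : IsManifold (𝓡 n) ∞ (Arrow n π) :=
  etaleIsManifold isLocalHomeomorph_src

end Arrow

variable (n π)

/-- Two points are equivalent if there is an arrow from one to the other. -/
def orbitSetoid : Setoid M where
  r p q := ∃ a : Arrow n π, a.src = p ∧ a.tgt = q
  iseqv :=
    { refl := fun p => ⟨.unit p, rfl, rfl⟩
      symm := by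
        rintro _ _ ⟨a, rfl, rfl⟩
        exact ⟨a.inv, a.src_inv, a.tgt_inv⟩
      trans := by
        rintro _ _ _ ⟨a, rfl, rfl⟩ ⟨b, h, rfl⟩
        exact ⟨Arrow.comp b a h, Arrow.src_comp b a h, Arrow.tgt_comp b a h⟩ }

/-- The orbit space of the groupoid of germs of transitions. -/
def OrbitSpace : Type u := Quotient (orbitSetoid n π)

/-- The map `ε` from the orbit space to `X` that sends the orbit of `p` to `π p`. -/
def orbitProj : OrbitSpace n π → X :=
  Quotient.lift π (by rintro _ _ ⟨a, rfl, rfl⟩; exact a.proj_tgt.symm)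

end Groupoid

section Embedding

variable {k n : ℕ} {N : Type u} [TopologicalSpace N] [ChartedSpace (EuclideanSpace ℝ (Fin k)) N]
  {M : Type v} [TopologicalSpace M] [ChartedSpace (EuclideanSpace ℝ (Fin n)) M]
  {Y X : Type w}

/-- A Lie groupoid embedding between groupoids of germs of transitions: a pair of smooth embeddings
(of the objects and of the arrows) which respects all the structure maps. -/
structure GroupoidEmbedding (k n : ℕ)
    {N : Type u} [TopologicalSpace N] [ChartedSpace (EuclideanSpace ℝ (Fin k)) N]
    {M : Type v} [TopologicalSpace M] [ChartedSpace (EuclideanSpace ℝ (Fin n)) M]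
    {Y X : Type w} (ρ : N → Y) (π : M → X) where
  obj : N → M
  arr : Arrow k ρ → Arrow n π
  obj_isSmoothEmbedding : IsSmoothEmbedding (𝓡 k) (𝓡 n) ∞ obj
  arr_isSmoothEmbedding : IsSmoothEmbedding (𝓡 k) (𝓡 n) ∞ arr
  src_arr : ∀ a, (arr a).src = obj a.src
  tgt_arr : ∀ a, (arr a).tgt = obj a.tgt
  arr_comp : ∀ (b a : Arrow k ρ) (h : b.src = a.tgt),
    arr (b.comp a h) = (arr b).comp (arr a) (by rw [src_arr, tgt_arr, h])
  arr_unit : ∀ p, arr (.unit p) = .unit (obj p)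
  arr_inv : ∀ a, arr a.inv = (arr a).inv

/-- The map `|Φ|` induced by `Φ` between the orbit spaces. -/
def GroupoidEmbedding.orbitMap {ρ : N → Y} {π : M → X} (Φ : GroupoidEmbedding k n ρ π) :
    OrbitSpace k ρ → OrbitSpace n π :=
  Quotient.map' Φ.obj (by
    rintro _ _ ⟨a, rfl, rfl⟩
    exact ⟨Φ.arr a, Φ.src_arr a, Φ.tgt_arr a⟩)

end Embedding

/-! ### Orbifold charts and atlases -/

/-- An `n`-dimensional orbifold chart `(U, Ũ/Γ, π)` on `X`. -/
structure OrbifoldChart (n : ℕ) (X : Type u) [TopologicalSpace X] where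
  /-- the manifold `Ũ` -/
  carrier : Type v
  [topology : TopologicalSpace carrier]
  [charted : ChartedSpace (EuclideanSpace ℝ (Fin n)) carrier]
  [isManifold : IsManifold (𝓡 n) ∞ carrier]
  [t2 : T2Space carrier]
  [secondCountable : SecondCountableTopology carrier]
  [connected : ConnectedSpace carrier]
  /-- the finite group `Γ`, which acts smoothly and effectively on `Ũ` -/
  group : Type v
  [groupStr : Group group]
  [finite : Finite group]
  [action : MulAction group carrier]
  [effective : FaithfulSMul group carrier]
  contMDiff_smul : ∀ γ : group, ContMDiff (𝓡 n) (𝓡 n) ∞ fun p : carrier => γ • p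
  /-- the open set `U` -/
  dom : TopologicalSpace.Opens X
  /-- the map `π`; it is invariant and induces a homeomorphism `Ũ/Γ → U` -/
  proj : carrier → X
  exists_homeomorph : ∃ e : MulAction.orbitRel.Quotient group carrier ≃ₜ dom,
    ∀ p : carrier, (e (Quotient.mk _ p) : X) = proj p

attribute [instance] OrbifoldChart.topology OrbifoldChart.charted OrbifoldChart.isManifold
  OrbifoldChart.t2 OrbifoldChart.secondCountable OrbifoldChart.connected OrbifoldChart.groupStr
  OrbifoldChart.finite OrbifoldChart.action OrbifoldChart.effective

namespace OrbifoldChart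

variable {n : ℕ} {X : Type u} [TopologicalSpace X] (c : OrbifoldChart.{u, v} n X)

theorem continuous_proj : Continuous c.proj := by
  obtain ⟨e, he⟩ := c.exists_homeomorph
  have : c.proj = fun p => (e (Quotient.mk _ p) : X) := funext fun p => (he p).symm
  rw [this]
  exact continuous_subtype_val.comp (e.continuous.comp continuous_quot_mk)

theorem proj_smul (γ : c.group) (p : c.carrier) : c.proj (γ • p) = c.proj p := by
  obtain ⟨e, he⟩ := c.exists_homeomorph
  rw [← he, ← he]
  exact congrArg (fun a => (e a : X)) (Quotient.sound ⟨γ, rfl⟩)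

theorem exists_smul_eq {p q : c.carrier} (h : c.proj p = c.proj q) : ∃ γ : c.group, γ • p = q := by
  obtain ⟨e, he⟩ := c.exists_homeomorph
  rw [← he, ← he] at h
  have := Quotient.exact (e.injective (Subtype.ext h)).symm
  exact this

/-- The image of a closed set is closed in the domain of the chart. -/
theorem exists_isClosed_image {T : Set c.carrier} (hT : IsClosed T) :
    ∃ D : Set X, IsClosed D ∧ ∀ p, c.proj p ∈ D ↔ ∃ q ∈ T, c.proj q = c.proj p := by
  obtain ⟨e, he⟩ := c.exists_homeomorph
  let Q : Set (MulAction.orbitRel.Quotient c.group c.carrier) := Quotient.mk _ '' T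
  have hmem : ∀ p : c.carrier, Quotient.mk _ p ∈ Q ↔ ∃ q ∈ T, c.proj q = c.proj p := by
    intro p
    constructor
    · rintro ⟨q, hq, h⟩
      exact ⟨q, hq, by rw [← he, ← he, h]⟩
    · rintro ⟨q, hq, h⟩
      rw [← he, ← he] at h
      exact ⟨q, hq, e.injective (Subtype.ext h)⟩
  have hQ : IsClosed Q := by
    have : (Quotient.mk _ ⁻¹' Q : Set c.carrier) = ⋃ γ : c.group, (fun p => γ • p) ⁻¹' T := by
      ext p
      rw [Set.mem_preimage, hmem, Set.mem_iUnion]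
      constructor
      · rintro ⟨q, hq, h⟩
        obtain ⟨γ, rfl⟩ := c.exists_smul_eq h.symm
        exact ⟨γ, hq⟩
      · rintro ⟨γ, hγ⟩
        exact ⟨_, hγ, c.proj_smul γ p⟩
    refine isQuotientMap_quot_mk.isClosed_preimage.1 ?_
    exact this ▸ isClosed_iUnion_of_finite fun γ => hT.preimage (c.contMDiff_smul γ).continuous
  obtain ⟨D, hD, hDQ⟩ := isClosed_induced_iff.1 ((e.isClosed_image).2 hQ)
  refine ⟨D, hD, fun p => ?_⟩
  rw [← hmem, ← he]
  change e (Quotient.mk _ p) ∈ Subtype.val ⁻¹' D ↔ _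
  rw [hDQ, e.injective.mem_set_image]

end OrbifoldChart

section Orbifolds

variable {n : ℕ} {X : Type u} [TopologicalSpace X]

/-- `f` is an injection from the chart `c` to the chart `d`. -/
structure IsInjection (c d : OrbifoldChart.{u, v} n X) (f : c.carrier → d.carrier) : Prop where
  isSmoothEmbedding : IsSmoothEmbedding (𝓡 n) (𝓡 n) ∞ f
  proj_apply : ∀ p, d.proj (f p) = c.proj p

/-- Compatibility of orbifold charts. -/
def Compatible (c d : OrbifoldChart.{u, v} n X) : Prop :=
  ∀ x ∈ (c.dom : Set X) ∩ d.dom, ∃ W : OrbifoldChart.{u, v} n X,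
    x ∈ W.dom ∧ (W.dom : Set X) ⊆ (c.dom : Set X) ∩ d.dom ∧
      (∃ f, IsInjection W c f) ∧ ∃ g, IsInjection W d g

/-- An orbifold atlas is a set of compatible charts whose domains cover `X`. -/
structure IsAtlas (𝒜 : Set (OrbifoldChart.{u, v} n X)) : Prop where
  compatible : ∀ c ∈ 𝒜, ∀ d ∈ 𝒜, Compatible c d
  exists_mem : ∀ x : X, ∃ c ∈ 𝒜, x ∈ c.dom

/-- A maximal orbifold atlas. -/
def IsMaximalAtlas (𝒜 : Set (OrbifoldChart.{u, v} n X)) : Prop :=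
  Maximal IsAtlas 𝒜

/-- The space of objects of the groupoid of a family of charts: the disjoint union of the `Ũ_i`. -/
abbrev Objects {ι : Type w} (A : ι → OrbifoldChart.{u, v} n X) : Type (max w v) :=
  Σ i, (A i).carrier

/-- The disjoint union of the maps `π_i`. -/
def totalProj {ι : Type w} (A : ι → OrbifoldChart.{u, v} n X) : Objects A → X :=
  fun p => (A p.1).proj p.2

end Orbifolds

/-! ### Suborbifold covers -/

section Suborbifolds

variable {n : ℕ} {X : Type u} [TopologicalSpace X] {ι : Type w}

/-- A subset `V` of a set with an action of `K` which is invariant under the subgroup `L`, and such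
that any two points of `V` in the same `K`-orbit are in the same `L`-orbit. For `V` an embedded
submanifold this says that `V` is an `L`-submanifold. -/
structure IsSubgroupSet {K S : Type*} [Group K] [MulAction K S] (L : Subgroup K) (V : Set S) :
    Prop where
  smul_mem : ∀ l ∈ L, ∀ p ∈ V, l • p ∈ V
  exists_smul_eq : ∀ (k : K), ∀ p ∈ V, k • p ∈ V → ∃ l ∈ L, l • p = k • p

/-- A `k`-dimensional suborbifold cover on `Y` with respect to the family of charts `A`: an index
set `J` and, for every `j ∈ J`, a connected embedded `k`-dimensional submanifold `V j` of `Ũ_j`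
which is a `Δ j`-submanifold for a subgroup `Δ j` of `Γ_j`, such that the sets `π_j(V j)` are
open in `Y` and cover `Y`. -/
structure SuborbifoldCover (k : ℕ) (A : ι → OrbifoldChart.{u, v} n X) (Y : Set X) where
  J : Set ι
  V : ∀ j : J, Set (A j).carrier
  charted : ∀ j : J, ChartedSpace (EuclideanSpace ℝ (Fin k)) (V j)
  isManifold : ∀ j : J, IsManifold (𝓡 k) ∞ (V j)
  isSmoothEmbedding : ∀ j : J, IsSmoothEmbedding (𝓡 k) (𝓡 n) ∞ (Subtype.val : V j → (A j).carrier)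
  isConnected : ∀ j : J, IsConnected (V j)
  Δ : ∀ j : J, Subgroup (A j).group
  isSubgroupSet : ∀ j : J, IsSubgroupSet (Δ j) (V j)
  isOpen_image : ∀ j : J, IsOpen ((↑) ⁻¹' ((A j).proj '' V j) : Set Y)
  iUnion_image : ⋃ j : J, (A j).proj '' V j = Y

attribute [instance] SuborbifoldCover.charted SuborbifoldCover.isManifold

namespace SuborbifoldCover

variable {k : ℕ} {A : ι → OrbifoldChart.{u, v} n X} {Y : Set X} (C : SuborbifoldCover k A Y)

/-- The cover is closed if every `V j` is closed in `Ũ_j`. -/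
def IsClosedCover : Prop := ∀ j, IsClosed (C.V j)

/-- The action of `Δ j` on `V j`. -/
def permHom (j : C.J) : C.Δ j →* Equiv.Perm (C.V j) where
  toFun δ :=
    { toFun := fun p => ⟨δ.1 • p.1, (C.isSubgroupSet j).smul_mem _ δ.2 _ p.2⟩
      invFun := fun p => ⟨δ.1⁻¹ • p.1, (C.isSubgroupSet j).smul_mem _ (inv_mem δ.2) _ p.2⟩
      left_inv := fun p => by simp
      right_inv := fun p => by simp }
  map_one' := by ext; simp
  map_mul' δ ε := by ext; simp [mul_smul]

/-- The group `Δ j / K j`, where `K j` is the kernel of the action of `Δ j` on `V j`. -/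
abbrev EffGroup (j : C.J) : Type v := C.Δ j ⧸ (C.permHom j).ker

/-- The effective action of `Δ j / K j` on `V j`. -/
instance effAction (j : C.J) : MulAction (C.EffGroup j) (C.V j) :=
  MulAction.compHom _ (QuotientGroup.kerLift (C.permHom j))

theorem coe_mk_smul (j : C.J) (δ : C.Δ j) (p : C.V j) :
    (((QuotientGroup.mk δ : C.EffGroup j) • p : C.V j) : (A j).carrier) = δ.1 • p.1 := rfl

instance effFaithful (j : C.J) : FaithfulSMul (C.EffGroup j) (C.V j) where
  eq_of_smul_eq_smul h :=
    QuotientGroup.kerLift_injective (C.permHom j) (Equiv.ext h)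

theorem proj_mem (j : C.J) (p : C.V j) : (A j).proj p ∈ Y :=
  C.iUnion_image.subset (Set.mem_iUnion.2 ⟨j, p, p.2, rfl⟩)

/-- The restriction of `π_j` to `V j`, as a map to `Y`. -/
def restrProj (j : C.J) (p : C.V j) : Y := ⟨(A j).proj p, C.proj_mem j p⟩

/-- The image of `V j` in `Y`, which is open. -/
def imageOpens (j : C.J) : TopologicalSpace.Opens Y :=
  ⟨(↑) ⁻¹' ((A j).proj '' C.V j), C.isOpen_image j⟩

/-- Every `(π_j(V j), V j / (Δ j / K j), π_j)` is an orbifold chart on `Y`, that is, `π_j` induces a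
homeomorphism from the quotient of `V j` onto its image. -/
def InducesCharts : Prop :=
  ∀ j, ∃ e : MulAction.orbitRel.Quotient (C.EffGroup j) (C.V j) ≃ₜ C.imageOpens j,
    ∀ p : C.V j, (e (Quotient.mk _ p) : Y) = C.restrProj j p

/-- A closed suborbifold cover induces orbifold charts. -/
theorem IsClosedCover.inducesCharts {C : SuborbifoldCover k A Y} (hC : C.IsClosedCover) :
    C.InducesCharts := by
  intro j
  have hcont : Continuous (C.restrProj j) :=
    ((A j).continuous_proj.comp continuous_subtype_val).subtype_mk _
  let f : C.V j → C.imageOpens j := fun p => ⟨C.restrProj j p, p, p.2, rfl⟩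
  have hf : Continuous f := hcont.subtype_mk _
  have hinv : ∀ p q : C.V j, MulAction.orbitRel (C.EffGroup j) (C.V j) p q ↔ f p = f q := by
    intro p q
    rw [MulAction.orbitRel_apply, MulAction.mem_orbit_iff]
    constructor
    · rintro ⟨δ, rfl⟩
      induction δ using QuotientGroup.induction_on with
      | H δ =>
        refine Subtype.ext (Subtype.ext ?_)
        exact (A j).proj_smul δ.1 q.1
    · intro h
      have h : (A j).proj q = (A j).proj p :=
        (congrArg (fun y : C.imageOpens j => ((y : Y) : X)) h).symm
      obtain ⟨γ, hγ⟩ := (A j).exists_smul_eq h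
      obtain ⟨δ, hδ, hδ'⟩ := (C.isSubgroupSet j).exists_smul_eq γ q q.2 (hγ ▸ p.2)
      exact ⟨QuotientGroup.mk ⟨δ, hδ⟩, Subtype.ext (hδ'.trans hγ)⟩
  let e : MulAction.orbitRel.Quotient (C.EffGroup j) (C.V j) ≃ C.imageOpens j :=
    Equiv.ofBijective (Quotient.lift f fun p q h => (hinv p q).1 h) (by
      constructor
      · intro a b
        induction a, b using Quotient.inductionOn₂
        exact fun h => Quotient.sound ((hinv _ _).2 h)
      · rintro ⟨⟨y, hy⟩, p, hp, h⟩
        exact ⟨Quotient.mk _ ⟨p, hp⟩, Subtype.ext (Subtype.ext h)⟩)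
  have hclosed : IsClosedMap e := by
    intro S hS
    have hT : IsClosed ((↑) '' (Quotient.mk _ ⁻¹' S : Set (C.V j)) : Set (A j).carrier) :=
      (hC j).isClosedMap_subtype_val _ (hS.preimage continuous_quot_mk)
    obtain ⟨D, hD, hDT⟩ := (A j).exists_isClosed_image hT
    have : e '' S = (fun y : C.imageOpens j => ((y : Y) : X)) ⁻¹' D := by
      ext ⟨⟨y, hy⟩, hyV⟩
      obtain ⟨p, hp, hpy⟩ := hyV
      change (A j).proj p = y at hpy
      subst hpy
      rw [Set.mem_preimage]
      change _ ↔ (A j).proj p ∈ D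
      rw [hDT p]
      constructor
      · rintro ⟨a, ha, h⟩
        induction a using Quotient.inductionOn with
        | h q => exact ⟨q, ⟨q, ha, rfl⟩, congrArg (fun y : C.imageOpens j => ((y : Y) : X)) h⟩
      · rintro ⟨_, ⟨q, hq, rfl⟩, h⟩
        exact ⟨Quotient.mk _ q, hq, Subtype.ext (Subtype.ext h)⟩
    rw [this]
    exact hD.preimage (continuous_subtype_val.comp continuous_subtype_val)
  exact ⟨e.toHomeomorphOfContinuousClosed (continuous_quot_lift _ hf) hclosed, fun _ => rfl⟩

/-- The orbifold atlas on `Y` induced by a suborbifold cover. -/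
def inducedAtlas (h : C.InducesCharts) (j : C.J) : OrbifoldChart.{u, v} k Y where
  carrier := C.V j
  connected := isConnected_iff_connectedSpace.1 (C.isConnected j)
  group := C.EffGroup j
  contMDiff_smul γ := by
    induction γ using QuotientGroup.induction_on with
    | H δ =>
      have h1 : ContMDiff (𝓡 k) (𝓡 n) ∞ fun p : C.V j => δ.1 • (p : (A j).carrier) :=
        ((A j).contMDiff_smul δ.1).comp (C.isSmoothEmbedding j).contMDiff
      intro p
      refine (ContMDiffAt.iff_comp_isImmersionAt
        ((C.isSmoothEmbedding j).isImmersion.isImmersionAt _)).2 ⟨?_, h1 p⟩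
      exact (h1.continuous.subtype_mk _).continuousAt
  dom := C.imageOpens j
  proj := C.restrProj j
  exists_homeomorph := h j

/-- The inclusion of the disjoint union of the `V j` into the disjoint union of the `Ũ_i`. -/
def inclusion (h : C.InducesCharts) : Objects (C.inducedAtlas h) → Objects A :=
  fun p => ⟨p.1, (show C.V p.1 from p.2).1⟩

/-- A suborbifold cover is strong if it is closed and there is a Lie groupoid embedding `Φ` from the
groupoid of the induced atlas to the groupoid of `A` such that `ε ∘ |Φ| = ε`. -/
def IsStrong : Prop :=
  ∃ (hC : C.IsClosedCover)
    (Φ : GroupoidEmbedding k n (totalProj (C.inducedAtlas hC.inducesCharts)) (totalProj A)),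
    ∀ o, orbitProj n (totalProj A) (Φ.orbitMap o) =
      ((orbitProj k (totalProj (C.inducedAtlas hC.inducesCharts)) o : Y) : X)

end SuborbifoldCover

/-- `A` is a countable atlas contained in `𝒜`. -/
structure IsCountableSubatlas (A : ι → OrbifoldChart.{u, v} n X)
    (𝒜 : Set (OrbifoldChart.{u, v} n X)) : Prop where
  countable : Countable ι
  mem : ∀ i, A i ∈ 𝒜
  isAtlas : IsAtlas (Set.range A)

/-- A `k`-dimensional strong suborbifold of the orbifold `(X, 𝒜)`. -/
def IsStrongSuborbifold (k : ℕ) (𝒜 : Set (OrbifoldChart.{u, v} n X)) (Y : Set X) : Prop :=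
  ∃ (ι : Type) (A : ι → OrbifoldChart.{u, v} n X), IsCountableSubatlas A 𝒜 ∧
    ∃ C : SuborbifoldCover k A Y, C.IsStrong

end Suborbifolds

end Orb

end

noncomputable section

namespace Orb

/-! ### Local diffeomorphisms -/

section LocalDiffeomorphisms

variable {E : Type*} [NormedAddCommGroup E] [NormedSpace ℝ E] {H : Type*} [TopologicalSpace H]
  {I : ModelWithCorners ℝ E H} {r : ℕ∞ω}
  {M : Type*} [TopologicalSpace M] [ChartedSpace H M]
  {N : Type*} [TopologicalSpace N] [ChartedSpace H N]
  {P : Type*} [TopologicalSpace P] [ChartedSpace H P]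

/-! All implications come from one construction, `exists_isClosedCover_obj_eq_inclusion`. It starts
from any groupoid embedding `Φ` over the identity of `X`, with no closedness assumed, and produces a
closed cover for another countable subatlas and an embedding whose object map is the inclusion.
Embeddings as in each of the three conditions cover the identity of `X`, and for a closed cover an
inclusion on objects makes the cover strong.

The new submanifolds are the images `Φ₀(S)` of small connected open sets `S`, taken inside small
slices of the ambient charts (`exists_localModel`). Let `Φ₀(y) = x`. If two points `z`, `z'` of `S`
have images in one orbit, they have the same image in `X`, hence in `Y`, so `z' = δ z`; inside a
slice at `y` the element `δ` fixes `y`. The arrow `Φ₁[δ]_y` goes from `x` to `x`, so it is the germ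
of a group element `γ`. Arrows near it are again germs of `γ`, and continuity of `Φ₁` gives `Φ₀(δ z)
= γ Φ₀(z)` near `y` (`exists_eventually_obj_smul`). With `S` invariant under the isotropy group of
`y`, this `γ` preserves `Φ₀(S)`, which is the orbit condition. Closedness holds because `Φ₀` is a
topological embedding: a small slice at `x` pulls back into a compact neighbourhood of `y`.

That germs over a chart are germs of group elements (`exists_eventuallyEq_smul`) is a rigidity
statement. A smooth germ moving points along orbits agrees with group elements on a dense set, and
only one element can occur arbitrarily close to a given point: two would have the same derivative
there, and a germ of finite order with identity derivative is trivial.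

The arrows are carried along by pullback. An arrow of the refined groupoid is determined,
topologically as well, by its source, its target and the germ it induces below (`injective_anchor`,
`isInducing_anchor`), so `Φ` pulls back along the local diffeomorphisms from the refined objects
(`GroupoidEmbedding.exists_obj_eq`). -/

theorem isLocalDiffeomorphAt_of_openPartialHomeomorph {a : N → M} {x : N}
    (φ : OpenPartialHomeomorph N M) (hx : x ∈ φ.source) (ha : Set.EqOn a φ φ.source)
    (h : ContMDiffOn I I r φ φ.source) (h' : ContMDiffOn I I r φ.symm φ.target) :
    IsLocalDiffeomorphAt I I r a x :=
  ⟨{ toPartialEquiv := φ.toPartialEquiv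
     open_source := φ.open_source
     open_target := φ.open_target
     contMDiffOn_toFun := h
     contMDiffOn_invFun := h' }, hx, ha⟩

/-- A local diffeomorphism is, near every point, a diffeomorphism between open subsets. -/
theorem exists_openPartialHomeomorph {a : N → M}
    (ha : IsLocalDiffeomorph I I r a) (x : N) :
    ∃ φ : OpenPartialHomeomorph N M, x ∈ φ.source ∧ ⇑φ = a ∧
      ContMDiffOn I I r φ φ.source ∧ ContMDiffOn I I r φ.symm φ.target := by
  obtain ⟨Φ, hx, he⟩ := ha x
  have he' : Set.EqOn a Φ.toOpenPartialHomeomorph Φ.toOpenPartialHomeomorph.source := he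
  -- The underlying function is `a` everywhere, not only on the source, so that `⇑φ = a` is an
  -- equality of functions and can be used for rewriting.
  refine ⟨{ Φ.toOpenPartialHomeomorph with
        toFun := a
        map_source' := fun _x hx ↦ by
          rw [he' hx]; exact Φ.toOpenPartialHomeomorph.map_source' hx
        left_inv' := fun _x hx ↦ by
          rw [he' hx]; exact Φ.toOpenPartialHomeomorph.left_inv' hx
        right_inv' := fun _y hy ↦ by
          rw [he' (Φ.toOpenPartialHomeomorph.map_target' hy)]
          exact Φ.toOpenPartialHomeomorph.right_inv' hy
        continuousOn_toFun :=
          (continuousOn_congr he').mpr Φ.toOpenPartialHomeomorph.continuousOn_toFun },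
      hx, rfl, ha.contMDiff.contMDiffOn, Φ.contMDiffOn_invFun⟩

/-- Near `s i y` the map `a` is a local inverse of `s i` followed by `a ∘ s i`. This lets local
diffeomorphisms out of a disjoint union be checked on the pieces. -/
theorem isLocalDiffeomorph_of_comp_surjective {ι : Type*} {Q : ι → Type*}
    [∀ i, TopologicalSpace (Q i)] [∀ i, ChartedSpace H (Q i)] {s : ∀ i, Q i → N} {a : N → M}
    (hs : ∀ i, IsLocalDiffeomorph I I r (s i)) (has : ∀ i, IsLocalDiffeomorph I I r (a ∘ s i))
    (hsurj : ∀ x, ∃ i y, s i y = x) : IsLocalDiffeomorph I I r a := by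
  intro x
  obtain ⟨i, y, rfl⟩ := hsurj x
  obtain ⟨φ, hy, hφ, h1, h2⟩ := exists_openPartialHomeomorph (hs i) y
  obtain ⟨ψ, hy', hψ, h3, h4⟩ := exists_openPartialHomeomorph (has i) y
  refine isLocalDiffeomorphAt_of_openPartialHomeomorph (φ.symm.trans ψ) ?_ ?_ ?_ ?_
  · rw [← hφ, OpenPartialHomeomorph.trans_source]
    refine ⟨φ.map_source hy, ?_⟩
    rw [Set.mem_preimage, φ.left_inv hy]
    exact hy'
  · intro z hz
    have hz1 : z ∈ φ.target := hz.1
    change a z = ψ (φ.symm z)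
    rw [hψ, Function.comp_apply, ← hφ, φ.right_inv hz1]
  · exact h3.comp (h2.mono fun _ h => h.1) fun _ h => h.2
  · exact h1.comp (h4.mono fun _ h => h.1) fun _ h => h.2

/-- Pulling back a chart along a diffeomorphism between open subsets gives a chart. -/
theorem trans_mem_maximalAtlas [IsManifold I r M] [IsManifold I r N]
    {φ : OpenPartialHomeomorph N M} (h : ContMDiffOn I I r φ φ.source)
    (h' : ContMDiffOn I I r φ.symm φ.target) {c : OpenPartialHomeomorph M H}
    (hc : c ∈ IsManifold.maximalAtlas I r M) : φ.trans c ∈ IsManifold.maximalAtlas I r N := by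
  refine OpenPartialHomeomorph.mem_maximalAtlas_of_contMDiffOn _ ?_ ?_
  · exact (contMDiffOn_of_mem_maximalAtlas hc).comp (h.mono fun _ h => h.1) fun _ h => h.2
  · exact h'.comp ((contMDiffOn_symm_of_mem_maximalAtlas hc).mono fun _ h => h.1) fun _ h => h.2

omit [ChartedSpace H N] in
/-- The smooth structure pulled back along a local homeomorphism makes it a local
diffeomorphism. -/
theorem isLocalDiffeomorph_etale [IsManifold I r M] {s : N → M} (hs : IsLocalHomeomorph s) :
    @IsLocalDiffeomorph ℝ _ E _ _ E _ _ H _ H _ I I N _ (etaleChartedSpace hs) M _ _ r s := by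
  let _ := etaleChartedSpace (H := H) hs
  have := etaleIsManifold (I := I) (r := r) hs
  intro x
  obtain ⟨φ, hx, hφ⟩ := hs x
  have hmem : ∀ c ∈ atlas H M, φ.trans c ∈ IsManifold.maximalAtlas I r N := fun c hc =>
    StructureGroupoid.subset_maximalAtlas _ ⟨φ, hφ.symm, c, hc, rfl⟩
  refine isLocalDiffeomorphAt_of_openPartialHomeomorph φ hx (by rw [hφ]; exact Set.eqOn_refl _ _)
    ?_ ?_
  · intro y hy
    have hc := hmem _ (chart_mem_atlas H (φ y))
    have hc' := IsManifold.chart_mem_maximalAtlas (I := I) (n := r) (φ y)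
    have h1 : ContMDiffAt I I r ((chartAt H (φ y)).symm ∘ (φ.trans (chartAt H (φ y)))) y :=
      (contMDiffAt_symm_of_mem_maximalAtlas hc'
        ((chartAt H (φ y)).map_source (mem_chart_source H (φ y)))).comp y
        (contMDiffAt_of_mem_maximalAtlas hc ⟨hy, mem_chart_source H (φ y)⟩)
    refine (h1.congr_of_eventuallyEq ?_).contMDiffWithinAt
    filter_upwards [(φ.trans (chartAt H (φ y))).open_source.mem_nhds
      ⟨hy, mem_chart_source H (φ y)⟩] with z hz
    exact ((chartAt H (φ y)).left_inv hz.2).symm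
  · intro y hy
    have hc := hmem _ (chart_mem_atlas H y)
    have hc' := IsManifold.chart_mem_maximalAtlas (I := I) (n := r) y
    have h1 : ContMDiffAt I I r ((φ.trans (chartAt H y)).symm ∘ (chartAt H y)) y :=
      (contMDiffAt_symm_of_mem_maximalAtlas hc (by
        refine ⟨(chartAt H y).map_source (mem_chart_source H y), ?_⟩
        rw [Set.mem_preimage, (chartAt H y).left_inv (mem_chart_source H y)]
        exact hy)).comp y
        (contMDiffAt_of_mem_maximalAtlas hc' (mem_chart_source H y))
    refine (h1.congr_of_eventuallyEq ?_).contMDiffWithinAt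
    filter_upwards [(chartAt H y).open_source.mem_nhds (mem_chart_source H y)] with z hz
    exact congrArg φ.symm ((chartAt H y).left_inv hz).symm

theorem isLocalDiffeomorph_sigmaMk {ι : Type*} {Q : ι → Type*} [Nonempty H]
    [∀ i, TopologicalSpace (Q i)] [∀ i, ChartedSpace H (Q i)] [∀ i, IsManifold I r (Q i)] (i : ι) :
    IsLocalDiffeomorph I I r (Sigma.mk i : Q i → Σ i, Q i) := by
  intro x
  have : Nonempty (Q i) := ⟨x⟩
  have hi : Topology.IsOpenEmbedding (Sigma.mk i : Q i → Σ i, Q i) := .sigmaMk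
  have hmem : ∀ c ∈ atlas H (Q i), c.lift_openEmbedding hi ∈
      IsManifold.maximalAtlas I r (Σ i, Q i) := fun c hc =>
    StructureGroupoid.subset_maximalAtlas _ ⟨i, c, hc, rfl⟩
  refine isLocalDiffeomorphAt_of_openPartialHomeomorph (hi.toOpenPartialHomeomorph) trivial
    (Set.eqOn_refl _ _) ?_ ?_
  · intro y _
    have hc := hmem _ (chart_mem_atlas H y)
    have hc' := IsManifold.chart_mem_maximalAtlas (I := I) (n := r) y
    have h1 : ContMDiffAt I I r (((chartAt H y).lift_openEmbedding hi).symm ∘ (chartAt H y)) y :=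
      (contMDiffAt_symm_of_mem_maximalAtlas hc
        ((chartAt H y).map_source (mem_chart_source H y))).comp y
        (contMDiffAt_of_mem_maximalAtlas hc' (mem_chart_source H y))
    refine (h1.congr_of_eventuallyEq ?_).contMDiffWithinAt
    filter_upwards [(chartAt H y).open_source.mem_nhds (mem_chart_source H y)] with z hz
    exact congrArg (Sigma.mk i) ((chartAt H y).left_inv hz).symm
  · intro y hy
    rw [Topology.IsOpenEmbedding.toOpenPartialHomeomorph_target] at hy
    obtain ⟨y, rfl⟩ := hy
    have hc := hmem _ (chart_mem_atlas H y)
    have hc' := IsManifold.chart_mem_maximalAtlas (I := I) (n := r) y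
    have hy' : (⟨i, y⟩ : Σ i, Q i) ∈ ((chartAt H y).lift_openEmbedding hi).source :=
      ⟨y, mem_chart_source H y, rfl⟩
    have h1 : ContMDiffAt I I r
        ((chartAt H y).symm ∘ ((chartAt H y).lift_openEmbedding hi)) (⟨i, y⟩ : Σ i, Q i) :=
      (contMDiffAt_symm_of_mem_maximalAtlas hc' (by
        rw [(chartAt H y).lift_openEmbedding_apply hi]
        exact (chartAt H y).map_source (mem_chart_source H y))).comp _
        (contMDiffAt_of_mem_maximalAtlas hc hy')
    refine (h1.congr_of_eventuallyEq ?_).contMDiffWithinAt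
    filter_upwards [((chartAt H y).lift_openEmbedding hi).open_source.mem_nhds hy'] with z hz
    obtain ⟨w, hw, rfl⟩ := hz
    rw [Function.comp_apply, (chartAt H y).lift_openEmbedding_apply hi, (chartAt H y).left_inv hw]
    exact hi.toOpenPartialHomeomorph_left_inv ..

theorem isLocalDiffeomorph_sigma_desc {ι : Type*} {Q : ι → Type*} [Nonempty H]
    [∀ i, TopologicalSpace (Q i)] [∀ i, ChartedSpace H (Q i)] [∀ i, IsManifold I r (Q i)]
    {a : (Σ i, Q i) → M} (ha : ∀ i, IsLocalDiffeomorph I I r fun x : Q i => a ⟨i, x⟩) :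
    IsLocalDiffeomorph I I r a :=
  isLocalDiffeomorph_of_comp_surjective isLocalDiffeomorph_sigmaMk ha fun x => ⟨x.1, x.2, rfl⟩

theorem isLocalDiffeomorph_opens_val [IsManifold I r M] (U : TopologicalSpace.Opens M) :
    IsLocalDiffeomorph I I r (Subtype.val : U → M) := by
  intro x
  refine isLocalDiffeomorphAt_of_openPartialHomeomorph (U.openPartialHomeomorphSubtypeCoe ⟨x⟩)
    trivial (Set.eqOn_refl _ _) contMDiff_subtype_val.contMDiffOn ?_
  intro y hy
  have hy' : y ∈ (U : Set M) := by
    rwa [TopologicalSpace.Opens.openPartialHomeomorphSubtypeCoe_target] at hy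
  refine ContMDiffAt.contMDiffWithinAt ?_
  -- Smoothness of the local inverse is tested after the inclusion, an immersion, where it becomes
  -- the identity.
  refine (ContMDiffAt.iff_comp_isImmersionAt
    ((IsSmoothEmbedding.of_opens U).isImmersion.isImmersionAt _)).2
    ⟨OpenPartialHomeomorph.continuousAt_symm _ hy, contMDiffAt_id.congr_of_eventuallyEq ?_⟩
  filter_upwards [U.isOpen.mem_nhds hy'] with z hz
  exact (U.openPartialHomeomorphSubtypeCoe ⟨x⟩).right_inv
    (by rwa [TopologicalSpace.Opens.openPartialHomeomorphSubtypeCoe_target])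

theorem isLocalDiffeomorph_comp {a : N → M} {b : P → N} (ha : IsLocalDiffeomorph I I r a)
    (hb : IsLocalDiffeomorph I I r b) : IsLocalDiffeomorph I I r (a ∘ b) :=
  fun x => IsLocalDiffeomorphAt.comp (hf := hb x) (hg := ha (b x)) ..

variable {E' : Type w} [NormedAddCommGroup E'] [NormedSpace ℝ E'] {H' : Type*} [TopologicalSpace H']
  {J : ModelWithCorners ℝ E' H'}
  {S : Type*} [TopologicalSpace S] [ChartedSpace H' S]
  {T : Type*} [TopologicalSpace T] [ChartedSpace H' T]

/-- Pulling the domain chart back along a sheet of `a` leaves the local normal form of `f`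
unchanged. -/
theorem isImmersion_comp_isLocalDiffeomorph [IsManifold I r M] [IsManifold I r N] {f : M → S}
    (hf : Manifold.IsImmersion I J r f) {a : N → M} (ha : IsLocalDiffeomorph I I r a) :
    Manifold.IsImmersion I J r (f ∘ a) := by
  obtain ⟨F, iF, iF2, hf⟩ := hf
  refine ⟨F, iF, iF2, fun x => ?_⟩
  obtain ⟨φ, hx, hφ, h1, h2⟩ := exists_openPartialHomeomorph ha x
  have h := hf (a x)
  refine .mk_of_charts h.equiv (φ.trans h.domChart) h.codChart
    ⟨hx, ?_⟩ h.mem_codChart_source (trans_mem_maximalAtlas h1 h2 h.domChart_mem_maximalAtlas)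
    h.codChart_mem_maximalAtlas ?_ ?_
  · change φ x ∈ h.domChart.source
    rw [congrFun hφ x]
    exact h.mem_domChart_source
  · intro y hy
    have : φ y ∈ h.domChart.source := hy.2
    rw [hφ] at this
    exact h.source_subset_preimage_source this
  · intro z hz
    have hz' : z ∈ (h.domChart.extend I).target := by
      simp only [mfld_simps] at hz ⊢
      exact ⟨hz.1, hz.2.1⟩
    rw [← h.writtenInCharts hz']
    have hz2 : h.domChart.symm (I.symm z) ∈ φ.target := by
      simp only [mfld_simps] at hz
      exact hz.2.2
    have hz3 : a (φ.symm (h.domChart.symm (I.symm z))) = h.domChart.symm (I.symm z) := 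
      (congrFun hφ _).symm.trans (φ.right_inv hz2)
    simp only [mfld_simps]
    exact congrArg (fun t => J (h.codChart (f t))) hz3

/-- Here the codomain chart is pulled back along a sheet of `b`. Continuity of `f` allows the domain
chart to be shrunk until `f` stays in that sheet. -/
theorem isImmersion_of_isLocalDiffeomorph_comp [IsManifold J r S] [IsManifold J r T]
    [IsManifold I r M] {f : M → S} {b : S → T} (hf : Manifold.IsImmersion I J r (b ∘ f))
    (hb : IsLocalDiffeomorph J J r b) (hfc : Continuous f) : Manifold.IsImmersion I J r f := by
  obtain ⟨F, iF, iF2, hf⟩ := hf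
  refine ⟨F, iF, iF2, fun x => ?_⟩
  obtain ⟨φ, hx, hφ, h1, h2⟩ := exists_openPartialHomeomorph hb (f x)
  have h := hf x
  have hO : IsOpen (f ⁻¹' φ.source) := φ.open_source.preimage hfc
  have hmem : h.domChart.restrOpen _ hO ∈ IsManifold.maximalAtlas I r M := by
    refine OpenPartialHomeomorph.mem_maximalAtlas_of_contMDiffOn _ ?_ ?_
    · exact (contMDiffOn_of_mem_maximalAtlas h.domChart_mem_maximalAtlas).mono fun _ h => h.1
    · exact (contMDiffOn_symm_of_mem_maximalAtlas h.domChart_mem_maximalAtlas).mono fun _ h => h.1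
  refine .mk_of_charts h.equiv (h.domChart.restrOpen _ hO) (φ.trans h.codChart)
    ⟨h.mem_domChart_source, hx⟩ ⟨hx, ?_⟩ hmem
    (trans_mem_maximalAtlas h1 h2 h.codChart_mem_maximalAtlas) ?_ ?_
  · change φ (f x) ∈ h.codChart.source
    rw [congrFun hφ (f x)]
    exact h.mem_codChart_source
  · rintro y ⟨hy, hy'⟩
    refine ⟨hy', ?_⟩
    change φ (f y) ∈ h.codChart.source
    rw [congrFun hφ (f y)]
    exact h.source_subset_preimage_source hy
  · intro z hz
    have hz' : z ∈ (h.domChart.extend I).target := by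
      simp only [mfld_simps] at hz ⊢
      exact ⟨hz.1, hz.2.1⟩
    rw [← h.writtenInCharts hz']
    simp only [mfld_simps, hφ]

end LocalDiffeomorphisms

/-! ### Germs of transitions and local diffeomorphisms -/

namespace Arrow

section Germs

variable {n : ℕ} {M : Type*} [TopologicalSpace M] [ChartedSpace (EuclideanSpace ℝ (Fin n)) M]
  {X : Type*} {π : M → X}

theorem mk_eq_mk {f g : OpenPartialHomeomorph M M} {hf : IsTransition n π f}
    {hg : IsTransition n π g} {p q : M} {hp : p ∈ f.source} {hq : q ∈ g.source} :
    mk f hf p hp = mk g hg q hq ↔ p = q ∧ f =ᶠ[𝓝 p] g :=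
  Quotient.eq

theorem exists_eq_mk (α : Arrow n π) : ∃ f, ∃ hf : IsTransition n π f, ∃ p, ∃ hp : p ∈ f.source,
    α = mk f hf p hp :=
  Quotient.inductionOn α fun x => ⟨x.map, x.isTransition, x.pt, x.pt_mem, rfl⟩

theorem comp_mk {f g : OpenPartialHomeomorph M M} (hf : IsTransition n π f)
    (hg : IsTransition n π g) {p q : M} (hp : p ∈ f.source) (hq : q ∈ g.source)
    (h : (mk g hg q hq).src = (mk f hf p hp).tgt) (h' : p ∈ (f.trans g).source) :
    comp (mk g hg q hq) (mk f hf p hp) h = mk (f.trans g) (hf.trans hg) p h' := rfl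

theorem inv_mk {f : OpenPartialHomeomorph M M} (hf : IsTransition n π f) {p : M}
    (hp : p ∈ f.source) : (mk f hf p hp).inv = mk f.symm hf.symm (f p) (f.map_source hp) := rfl

/-- The arrows near `[f]_p` are the germs of `f` at the points near `p`. -/
theorem eventually_nhds_mk {f : OpenPartialHomeomorph M M} {hf : IsTransition n π f} {p : M}
    {hp : p ∈ f.source} {P : Arrow n π → Prop} :
    (∀ᶠ α in 𝓝 (mk f hf p hp), P α) ↔ ∀ᶠ q in 𝓝 p, ∀ hq : q ∈ f.source, P (mk f hf q hq) := by
  constructor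
  · intro h
    have := (continuous_mk f hf).continuousAt (x := ⟨p, hp⟩) |>.eventually h
    rw [nhds_subtype_eq_comap, Filter.eventually_comap] at this
    filter_upwards [this] with q h hq
    exact h ⟨q, hq⟩ rfl
  · intro h
    obtain ⟨O, hO, hOo, hpO⟩ := eventually_nhds_iff.1 h
    filter_upwards [(isOpen_range_mk _ (hf.restr hOo)).mem_nhds
      ⟨⟨p, hp, hpO⟩, mk_eq_mk.2 ⟨rfl, .rfl⟩⟩]
    rintro _ ⟨⟨q, hq⟩, rfl⟩
    have h' : mk _ (hf.restr hOo) q hq = mk f hf q hq.1 := mk_eq_mk.2 ⟨rfl, .rfl⟩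
    change P (mk _ (hf.restr hOo) q hq)
    exact h' ▸ hO q hq.2 hq.1

theorem continuous_tgt : Continuous (tgt : Arrow n π → M) := by
  refine continuous_iff_continuousAt.2 fun α => ?_
  obtain ⟨f, hf, p, hp, rfl⟩ := exists_eq_mk α
  intro O hO
  refine eventually_nhds_mk.2 ?_
  filter_upwards [f.continuousAt hp hO] with q h _ using h

end Germs

/-! ### Transport of germs along a local diffeomorphism -/

section Push

variable {n : ℕ} {N' : Type*} [TopologicalSpace N'] [ChartedSpace (EuclideanSpace ℝ (Fin n)) N']
  {N : Type*} [TopologicalSpace N] [ChartedSpace (EuclideanSpace ℝ (Fin n)) N]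
  {Y : Type*} {ρ : N → Y} {ρ' : N' → Y} {a : N' → N}
  (ha : IsLocalDiffeomorph (𝓡 n) (𝓡 n) ∞ a) (hρ : ∀ x, ρ (a x) = ρ' x)

/-- A restriction of a local diffeomorphism to a neighbourhood of a point on which it is a
diffeomorphism onto an open set. -/
def sheet (x : N') : OpenPartialHomeomorph N' N := (exists_openPartialHomeomorph ha x).choose

theorem mem_sheet_source (x : N') : x ∈ (sheet ha x).source :=
  (exists_openPartialHomeomorph ha x).choose_spec.1

theorem coe_sheet (x : N') : ⇑(sheet ha x) = a :=
  (exists_openPartialHomeomorph ha x).choose_spec.2.1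

theorem contMDiffOn_sheet (x : N') :
    ContMDiffOn (𝓡 n) (𝓡 n) ∞ (sheet ha x) (sheet ha x).source :=
  (exists_openPartialHomeomorph ha x).choose_spec.2.2.1

theorem contMDiffOn_sheet_symm (x : N') :
    ContMDiffOn (𝓡 n) (𝓡 n) ∞ (sheet ha x).symm (sheet ha x).target :=
  (exists_openPartialHomeomorph ha x).choose_spec.2.2.2

theorem apply_mem_sheet_target {x y : N'} (h : y ∈ (sheet ha x).source) :
    a y ∈ (sheet ha x).target := by
  have := (sheet ha x).map_source h
  rwa [coe_sheet] at this

theorem sheet_symm_apply {x y : N'} (h : y ∈ (sheet ha x).source) :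
    (sheet ha x).symm (a y) = y := by
  have := (sheet ha x).left_inv h
  rwa [coe_sheet] at this

theorem apply_sheet_symm {x : N'} {y : N} (h : y ∈ (sheet ha x).target) :
    a ((sheet ha x).symm y) = y := by
  have := (sheet ha x).right_inv h
  rwa [coe_sheet] at this

include hρ in
theorem isTransition_push {f : OpenPartialHomeomorph N' N'} (hf : IsTransition n ρ' f) (x y : N') :
    IsTransition n ρ ((sheet ha x).symm.trans (f.trans (sheet ha y))) where
  contMDiffOn :=
    ((contMDiffOn_sheet ha y).comp (hf.contMDiffOn.mono fun _ h => h.1) fun _ h => h.2).comp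
      ((contMDiffOn_sheet_symm ha x).mono fun _ h => h.1) fun _ h => h.2
  contMDiffOn_symm :=
    (contMDiffOn_sheet ha x).comp ((hf.contMDiffOn_symm.comp
      ((contMDiffOn_sheet_symm ha y).mono fun _ h => h.1.1) fun _ h => h.1.2)) fun _ h => h.2
  proj_apply z hz := by
    change ρ (sheet ha y (f ((sheet ha x).symm z))) = ρ z
    have h1 : (sheet ha x).symm z ∈ f.source := hz.2.1
    rw [coe_sheet, hρ, hf.proj_apply _ h1, ← hρ, apply_sheet_symm ha hz.1]

include hρ in
theorem isTransition_lift {g : OpenPartialHomeomorph N N} (hg : IsTransition n ρ g) (x y : N') :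
    IsTransition n ρ' ((sheet ha x).trans (g.trans (sheet ha y).symm)) where
  contMDiffOn :=
    ((contMDiffOn_sheet_symm ha y).comp (hg.contMDiffOn.mono fun _ h => h.1) fun _ h => h.2).comp
      ((contMDiffOn_sheet ha x).mono fun _ h => h.1) fun _ h => h.2
  contMDiffOn_symm :=
    (contMDiffOn_sheet_symm ha x).comp ((hg.contMDiffOn_symm.comp
      ((contMDiffOn_sheet ha y).mono fun _ h => h.1.1) fun _ h => h.1.2)) fun _ h => h.2
  proj_apply z hz := by
    change ρ' ((sheet ha y).symm (g (sheet ha x z))) = ρ' z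
    have h1 : sheet ha x z ∈ g.source := hz.2.1
    have h2 : g (sheet ha x z) ∈ (sheet ha y).target := hz.2.2
    rw [← hρ, apply_sheet_symm ha h2, hg.proj_apply _ h1, coe_sheet, hρ]

theorem mem_push_source {f : OpenPartialHomeomorph N' N'} {p : N'} (hp : p ∈ f.source) :
    a p ∈ ((sheet ha p).symm.trans (f.trans (sheet ha (f p)))).source := by
  refine ⟨apply_mem_sheet_target ha (mem_sheet_source ha p), ?_⟩
  change (sheet ha p).symm (a p) ∈ (f.trans (sheet ha (f p))).source
  rw [sheet_symm_apply ha (mem_sheet_source ha p)]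
  exact ⟨hp, mem_sheet_source ha _⟩

/-- The germ `[a ∘ f ∘ a⁻¹]_{a p}` induced by `[f]_p`, for a local diffeomorphism `a`. -/
def push : Arrow n ρ' → Arrow n ρ :=
  Quotient.lift (fun x => mk _ (isTransition_push ha hρ x.isTransition x.pt (x.map x.pt)) (a x.pt)
    (mem_push_source ha x.pt_mem)) fun x y h => by
      obtain ⟨f, hf, p, hp⟩ := x
      obtain ⟨g, hg, q, hq⟩ := y
      obtain ⟨rfl, h⟩ : p = q ∧ f =ᶠ[𝓝 p] g := h
      refine mk_eq_mk.2 ⟨rfl, ?_⟩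
      have ht := apply_mem_sheet_target ha (mem_sheet_source ha p)
      have hc := (sheet ha p).continuousAt_symm ht
      unfold ContinuousAt at hc
      rw [sheet_symm_apply ha (mem_sheet_source ha p)] at hc
      filter_upwards [hc.eventually h] with z hz
      change sheet ha (f p) (f ((sheet ha p).symm z)) = sheet ha (g p) (g ((sheet ha p).symm z))
      rw [coe_sheet, coe_sheet, hz]

/-- `push [f]_p` is the germ of any transition `g` with `g ∘ a = a ∘ f` near `p`. -/
theorem push_mk_eq {f : OpenPartialHomeomorph N' N'} {hf : IsTransition n ρ' f} {p : N'}
    {hp : p ∈ f.source} {g : OpenPartialHomeomorph N N} {hg : IsTransition n ρ g} {q : N}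
    {hq : q ∈ g.source} :
    push ha hρ (mk f hf p hp) = mk g hg q hq ↔ a p = q ∧ a ∘ f =ᶠ[𝓝 p] g ∘ a := by
  refine mk_eq_mk.trans (and_congr_right ?_)
  rintro rfl
  have ht := apply_mem_sheet_target ha (mem_sheet_source ha p)
  constructor
  · intro h
    have hc := ha.contMDiff.continuous.continuousAt (x := p)
    filter_upwards [hc.eventually h, (sheet ha p).open_source.mem_nhds (mem_sheet_source ha p)]
      with z hz hz'
    rw [Function.comp_apply, Function.comp_apply, ← hz]
    change _ = sheet ha (f p) (f ((sheet ha p).symm (a z)))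
    rw [sheet_symm_apply ha hz', coe_sheet]
  · intro h
    have hc := (sheet ha p).continuousAt_symm ht
    unfold ContinuousAt at hc
    rw [sheet_symm_apply ha (mem_sheet_source ha p)] at hc
    filter_upwards [hc.eventually h, (sheet ha p).open_target.mem_nhds ht] with z hz hz'
    change sheet ha (f p) (f ((sheet ha p).symm z)) = g z
    rw [coe_sheet]
    refine hz.trans ?_
    rw [Function.comp_apply, apply_sheet_symm ha hz']

theorem src_push (α : Arrow n ρ') : (push ha hρ α).src = a α.src :=
  Quotient.inductionOn α fun _ => rfl

theorem tgt_push (α : Arrow n ρ') : (push ha hρ α).tgt = a α.tgt := by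
  obtain ⟨f, hf, p, hp, rfl⟩ := exists_eq_mk α
  change sheet ha (f p) (f ((sheet ha p).symm (a p))) = a (f p)
  rw [sheet_symm_apply ha (mem_sheet_source ha p), coe_sheet]

theorem push_unit (p : N') : push ha hρ (unit p) = unit (a p) :=
  (push_mk_eq ha hρ).2 ⟨rfl, .rfl⟩

theorem push_comp (β α : Arrow n ρ') (h : β.src = α.tgt) :
    push ha hρ (β.comp α h) = (push ha hρ β).comp (push ha hρ α)
      (by rw [src_push, tgt_push, h]) := by
  obtain ⟨f, hf, p, hp, rfl⟩ := exists_eq_mk α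
  obtain ⟨g, hg, q, hq, rfl⟩ := exists_eq_mk β
  obtain rfl : q = f p := h
  obtain ⟨f', hf', p', hp', hf1⟩ := exists_eq_mk (push ha hρ (mk f hf p hp))
  obtain ⟨g', hg', q', hq', hg1⟩ := exists_eq_mk (push ha hρ (mk g hg (f p) hq))
  obtain ⟨rfl, hf2⟩ := (push_mk_eq ha hρ).1 hf1
  obtain ⟨rfl, hg2⟩ := (push_mk_eq ha hρ).1 hg1
  have hfp : a (f p) = f' (a p) := hf2.eq_of_nhds
  have hmem : a p ∈ (f'.trans g').source := 
    ⟨hp', show f' (a p) ∈ g'.source from hfp ▸ hq'⟩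
  simp only [hf1, hg1]
  rw [comp_mk hf hg hp hq rfl ⟨hp, hq⟩, comp_mk hf' hg' hp' hq' hfp hmem]
  refine (push_mk_eq ha hρ).2 ⟨rfl, ?_⟩
  filter_upwards [hf2, (f.continuousAt hp).eventually hg2] with z h1 h2
  change a (g (f z)) = g' (f' (a z))
  rw [← show a (f z) = f' (a z) from h1]
  exact h2

theorem push_inv (α : Arrow n ρ') : push ha hρ α.inv = (push ha hρ α).inv := by
  obtain ⟨f, hf, p, hp, rfl⟩ := exists_eq_mk α
  obtain ⟨f', hf', p', hp', hf1⟩ := exists_eq_mk (push ha hρ (mk f hf p hp))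
  obtain ⟨rfl, hf2⟩ := (push_mk_eq ha hρ).1 hf1
  have hfp : a (f p) = f' (a p) := hf2.eq_of_nhds
  rw [hf1, inv_mk, inv_mk]
  refine (push_mk_eq ha hρ).2 ⟨hfp, ?_⟩
  have hc := f.continuousAt_symm (f.map_source hp)
  unfold ContinuousAt at hc
  rw [f.left_inv hp] at hc
  have hc2 := ha.contMDiff.continuous.continuousAt (x := p)
  filter_upwards [hc.eventually hf2, f.open_target.mem_nhds (f.map_source hp),
    hc.eventually (hc2.eventually (f'.open_source.mem_nhds hp'))] with z h1 h2 h3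
  rw [Function.comp_apply, Function.comp_apply, f.right_inv h2] at h1
  rw [Function.comp_apply, Function.comp_apply, h1, f'.left_inv h3]

/-- Germs lift along a local diffeomorphism. -/
theorem exists_push_eq (x y : N') (α : Arrow n ρ) (hx : α.src = a x) (hy : α.tgt = a y) :
    ∃ β : Arrow n ρ', β.src = x ∧ β.tgt = y ∧ push ha hρ β = α := by
  obtain ⟨g, hg, p, hp, rfl⟩ := exists_eq_mk α
  obtain rfl : p = a x := hx
  have hy : g (a x) = a y := hy
  have hmem : x ∈ ((sheet ha x).trans (g.trans (sheet ha y).symm)).source := by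
    refine ⟨mem_sheet_source ha x, ?_⟩
    change sheet ha x x ∈ (g.trans (sheet ha y).symm).source
    rw [coe_sheet]
    refine ⟨hp, ?_⟩
    change g (a x) ∈ (sheet ha y).target
    rw [hy]
    exact apply_mem_sheet_target ha (mem_sheet_source ha y)
  refine ⟨mk _ (isTransition_lift ha hρ hg x y) x hmem, rfl, ?_, ?_⟩
  · change (sheet ha y).symm (g (sheet ha x x)) = y
    rw [coe_sheet, hy, sheet_symm_apply ha (mem_sheet_source ha y)]
  · refine (push_mk_eq ha hρ).2 ⟨rfl, ?_⟩
    filter_upwards [OpenPartialHomeomorph.open_source _ |>.mem_nhds hmem] with z hz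
    have h2 : g (sheet ha x z) ∈ (sheet ha y).target := hz.2.2
    change a ((sheet ha y).symm (g (sheet ha x z))) = g (a z)
    rw [apply_sheet_symm ha h2, coe_sheet]

/-- The source, the image under `push` and the target of an arrow. -/
def anchor (α : Arrow n ρ') : N' × Arrow n ρ × N' := (α.src, push ha hρ α, α.tgt)

theorem continuous_push : Continuous (push ha hρ) := by
  refine continuous_generateFrom_iff.2 ?_
  rintro _ ⟨g, hg, rfl⟩
  refine isOpen_iff_mem_nhds.2 ?_
  rintro α ⟨⟨q, hq⟩, hα⟩
  obtain ⟨f, hf, p, hp, rfl⟩ := exists_eq_mk α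
  obtain ⟨rfl, h⟩ := (push_mk_eq ha hρ).1 hα.symm
  refine eventually_nhds_mk.2 ?_
  have hc := ha.contMDiff.continuous.continuousAt (x := p)
  filter_upwards [eventually_eventually_nhds.2 h, hc.eventually (g.open_source.mem_nhds hq)]
    with z hz hzg hz'
  exact ⟨⟨a z, hzg⟩, ((push_mk_eq ha hρ).2 ⟨rfl, hz⟩).symm⟩

/-- Suppose the anchor of `[f']_{p'}` is close to that of `[f]_p`. Then `p'` is close to `p`, the
pushed germ is a germ of the same `g` as for `f`, and `f' p'` lies in the sheet at `f p`. So `a ∘ f'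
= g ∘ a = a ∘ f` near `p'` with both values in one sheet, where `a` is injective. Hence `[f']_{p'} =
[f]_{p'}`, which is close to `[f]_p`. -/
theorem isInducing_anchor : Topology.IsInducing (anchor ha hρ) := by
  have hcont : Continuous (anchor ha hρ) :=
    continuous_src.prodMk ((continuous_push ha hρ).prodMk continuous_tgt)
  refine Topology.isInducing_iff_nhds.2 fun α => le_antisymm hcont.continuousAt.le_comap ?_
  obtain ⟨f, hf, p, hp, rfl⟩ := exists_eq_mk α
  obtain ⟨g, hg, q, hq, hg1⟩ := exists_eq_mk (push ha hρ (mk f hf p hp))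
  obtain ⟨rfl, hg2⟩ := (push_mk_eq ha hρ).1 hg1
  intro S hS
  have hS' := eventually_nhds_mk.1 hS
  have h1 : ∀ᶠ z in 𝓝 p, (∀ hz : z ∈ f.source, mk f hf z hz ∈ S) ∧ z ∈ f.source ∧
      f z ∈ (sheet ha (f p)).source ∧ a ∘ f =ᶠ[𝓝 z] g ∘ a := by
    filter_upwards [hS', f.open_source.mem_nhds hp, (f.continuousAt hp).eventually
      ((sheet ha (f p)).open_source.mem_nhds (mem_sheet_source ha _)),
      eventually_eventually_nhds.2 hg2] with z h1 h2 h3 h4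
    exact ⟨h1, h2, h3, h4⟩
  have h2 : ∀ᶠ y in 𝓝 (f p), y ∈ (sheet ha (f p)).source :=
    (sheet ha (f p)).open_source.mem_nhds (mem_sheet_source ha _)
  have h3 : ∀ᶠ β in 𝓝 (push ha hρ (mk f hf p hp)), β ∈ Set.range fun q : g.source => mk g hg q q.2 :=
    (isOpen_range_mk g hg).mem_nhds ⟨⟨a p, hq⟩, hg1.symm⟩
  refine Filter.mem_of_superset (Filter.preimage_mem_comap (prod_mem_nhds h1 (prod_mem_nhds h3 h2)))
    ?_
  rintro β ⟨⟨hβ1, hβ2, hβ3, hβ4⟩, ⟨⟨q, hq'⟩, hβ5⟩, hβ6⟩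
  obtain ⟨f', hf', p', hp', rfl⟩ := exists_eq_mk β
  obtain ⟨rfl, hβ7⟩ := (push_mk_eq ha hρ).1 hβ5.symm
  have hβ6 : f' p' ∈ (sheet ha (f p)).source := hβ6
  have hβ3 : f p' ∈ (sheet ha (f p)).source := hβ3
  have hβ4 : a ∘ f =ᶠ[𝓝 p'] g ∘ a := hβ4
  convert hβ1 hβ2 using 1
  refine mk_eq_mk.2 ⟨rfl, ?_⟩
  filter_upwards [hβ4, hβ7,
    (f'.continuousAt hp').eventually ((sheet ha (f p)).open_source.mem_nhds hβ6),
    (f.continuousAt hβ2).eventually ((sheet ha (f p)).open_source.mem_nhds hβ3)] with z h1 h2 h3 h4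
  have : a (f' z) = a (f z) := h2.trans h1.symm
  rw [← sheet_symm_apply ha h3, this, sheet_symm_apply ha h4]

/-- The pushed germ determines `a ∘ f` near `p`, and the target selects the sheet of `a` through
which `f` is recovered. -/
theorem injective_anchor : Function.Injective (anchor ha hρ) := by
  intro β α h
  obtain ⟨f, hf, p, hp, rfl⟩ := exists_eq_mk α
  obtain ⟨f', hf', p', hp', rfl⟩ := exists_eq_mk β
  obtain rfl : p' = p := congrArg Prod.fst h
  have h2 : f' p' = f p' := congrArg (fun t => t.2.2) h
  have h1 : push ha hρ (mk f' hf' p' hp') = push ha hρ (mk f hf p' hp) := congrArg (fun t => t.2.1) h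
  obtain ⟨g, hg, q, hq, hg1⟩ := exists_eq_mk (push ha hρ (mk f hf p' hp))
  rw [hg1] at h1
  obtain ⟨rfl, h3⟩ := (push_mk_eq ha hρ).1 hg1
  obtain ⟨-, h4⟩ := (push_mk_eq ha hρ).1 h1
  refine mk_eq_mk.2 ⟨rfl, ?_⟩
  have hs := (sheet ha (f p')).open_source.mem_nhds (mem_sheet_source ha _)
  have hs' := hs
  rw [← h2] at hs'
  filter_upwards [h3, h4, (f'.continuousAt hp').eventually hs',
    (f.continuousAt hp).eventually hs] with z h5 h6 h7 h8
  have : a (f' z) = a (f z) := h6.trans h5.symm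
  rw [h2] at h7
  rw [← sheet_symm_apply ha h7, this, sheet_symm_apply ha h8]

end Push

end Arrow

theorem isLocalDiffeomorph_src {n : ℕ} {M : Type*} [TopologicalSpace M]
    [ChartedSpace (EuclideanSpace ℝ (Fin n)) M] [IsManifold (𝓡 n) ∞ M] {X : Type*} {π : M → X} :
    IsLocalDiffeomorph (𝓡 n) (𝓡 n) ∞ (Arrow.src : Arrow n π → M) :=
  isLocalDiffeomorph_etale Arrow.isLocalHomeomorph_src

/-! ### Pullback of groupoid embeddings along local diffeomorphisms -/

section Transfer

variable {k n : ℕ}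
  {N : Type*} [TopologicalSpace N] [ChartedSpace (EuclideanSpace ℝ (Fin k)) N]
  {N' : Type*} [TopologicalSpace N'] [ChartedSpace (EuclideanSpace ℝ (Fin k)) N']
  {M : Type*} [TopologicalSpace M] [ChartedSpace (EuclideanSpace ℝ (Fin n)) M]
  {M' : Type*} [TopologicalSpace M'] [ChartedSpace (EuclideanSpace ℝ (Fin n)) M']
  [IsManifold (𝓡 k) ∞ N'] [IsManifold (𝓡 n) ∞ M']
  {Y X : Type w} {ρ : N → Y} {ρ' : N' → Y} {π : M → X} {π' : M' → X}

/-- A groupoid embedding can be pulled back along local diffeomorphisms: if `a : N' → N` and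
`b : M' → M` are local diffeomorphisms, then a smooth embedding `N' → M'` over `Φ.obj` is the
object map of a groupoid embedding. -/
theorem GroupoidEmbedding.exists_obj_eq (Φ : GroupoidEmbedding k n ρ π) {a : N' → N} {b : M' → M}
    (ha : IsLocalDiffeomorph (𝓡 k) (𝓡 k) ∞ a) (hρ : ∀ x, ρ (a x) = ρ' x)
    (hb : IsLocalDiffeomorph (𝓡 n) (𝓡 n) ∞ b) (hπ : ∀ x, π (b x) = π' x)
    {ψ : N' → M'} (hψ : IsSmoothEmbedding (𝓡 k) (𝓡 n) ∞ ψ) (hψb : ∀ x, b (ψ x) = Φ.obj (a x)) :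
    ∃ Ψ : GroupoidEmbedding k n ρ' π', Ψ.obj = ψ := by
  -- The arrow map is forced: push down, apply `Φ`, and lift along `b` with endpoints prescribed by
  -- `ψ`.
  have key : ∀ α : Arrow k ρ', ∃ β : Arrow n π', β.src = ψ α.src ∧ β.tgt = ψ α.tgt ∧
      β.push hb hπ = Φ.arr (α.push ha hρ) := fun α =>
    Arrow.exists_push_eq hb hπ _ _ _ (by rw [Φ.src_arr, Arrow.src_push, hψb])
      (by rw [Φ.tgt_arr, Arrow.tgt_push, hψb])
  choose arr hsrc htgt hpush using key
  have uniq : ∀ {β β' : Arrow n π'}, β.src = β'.src → β.tgt = β'.tgt →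
      β.push hb hπ = β'.push hb hπ → β = β' := fun h1 h2 h3 =>
    Arrow.injective_anchor hb hπ (Prod.ext h1 (Prod.ext h3 h2))
  have hcomm : Arrow.anchor hb hπ ∘ arr =
      Prod.map ψ (Prod.map Φ.arr ψ) ∘ Arrow.anchor ha hρ :=
    funext fun α => Prod.ext (hsrc α) (Prod.ext (hpush α) (htgt α))
  -- In anchor coordinates `arr` is `ψ × Φ.arr × ψ`, a product of embeddings, and both anchors are
  -- embeddings.
  have hemb : Topology.IsEmbedding arr := by
    have h1 : Topology.IsEmbedding (Arrow.anchor hb hπ ∘ arr) := by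
      rw [hcomm]
      exact (hψ.isEmbedding.prodMap
        (Φ.arr_isSmoothEmbedding.isEmbedding.prodMap hψ.isEmbedding)).comp
        ⟨Arrow.isInducing_anchor ha hρ, Arrow.injective_anchor ha hρ⟩
    exact ⟨(Arrow.isInducing_anchor hb hπ).of_comp_iff.1 h1.isInducing,
      h1.injective.of_comp⟩
  refine ⟨⟨ψ, arr, hψ, ⟨?_, hemb⟩, hsrc, htgt, fun β α h => ?_, fun p => ?_, fun α => ?_⟩, rfl⟩
  -- The source maps are local diffeomorphisms, so `arr` is an immersion because `ψ` is.
  · refine isImmersion_of_isLocalDiffeomorph_comp ?_ isLocalDiffeomorph_src hemb.continuous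
    rw [show Arrow.src ∘ arr = ψ ∘ Arrow.src from funext hsrc]
    exact isImmersion_comp_isLocalDiffeomorph hψ.isImmersion isLocalDiffeomorph_src
  · refine uniq ?_ ?_ ?_
    · rw [hsrc, Arrow.src_comp, Arrow.src_comp, hsrc]
    · rw [htgt, Arrow.tgt_comp, Arrow.tgt_comp, htgt]
    · rw [hpush, Arrow.push_comp ha hρ β α h, Φ.arr_comp, Arrow.push_comp]
      simp only [hpush]
  · refine uniq ?_ ?_ ?_
    · rw [hsrc]; rfl
    · rw [htgt]; rfl
    · rw [hpush, Arrow.push_unit, Φ.arr_unit, Arrow.push_unit, hψb]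
  · refine uniq ?_ ?_ ?_
    · rw [hsrc, Arrow.src_inv, Arrow.src_inv, htgt]
    · rw [htgt, Arrow.tgt_inv, Arrow.tgt_inv, hsrc]
    · rw [hpush, Arrow.push_inv, Φ.arr_inv, Arrow.push_inv, hpush]

end Transfer

/-! ### Rigidity of finite group actions -/

section Rigidity

/-- A germ of finite order with derivative the identity is the identity. -/
theorem eventuallyEq_id_of_iterate {E : Type*} [NormedAddCommGroup E] [NormedSpace ℝ E]
    [CompleteSpace E] {g : E → E} {x : E} (hg : HasStrictFDerivAt g (.id ℝ E) x) (hx : g x = x)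
    {m : ℕ} (hm : 0 < m) (h : g^[m] =ᶠ[𝓝 x] id) : g =ᶠ[𝓝 x] id := by
  -- Averaging over the iterates: `s` has identity derivative at `x`, hence is injective near `x`,
  -- while `s ∘ g = s` near `x`. Together these force `g = id` there.
  let s : E → E := fun y => (m : ℝ)⁻¹ • ∑ i ∈ Finset.range m, g^[i] y
  have hs : HasStrictFDerivAt s ((ContinuousLinearEquiv.refl ℝ E : E ≃L[ℝ] E) : E →L[ℝ] E) x := by
    have h1 : HasStrictFDerivAt (fun y => ∑ i ∈ Finset.range m, g^[i] y)
        (∑ _i ∈ Finset.range m, ContinuousLinearMap.id ℝ E) x := by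
      refine HasStrictFDerivAt.fun_sum fun i _ => ?_
      have := hg.iterate hx i
      rwa [show (ContinuousLinearMap.id ℝ E) ^ i = ContinuousLinearMap.id ℝ E from
        one_pow i] at this
    refine (h1.const_smul (m : ℝ)⁻¹).congr_fderiv ?_
    ext v
    simp only [Finset.sum_const, Finset.card_range, _root_.smul_apply,
      ContinuousLinearMap.id_apply, ContinuousLinearEquiv.coe_refl]
    rw [← Nat.cast_smul_eq_nsmul ℝ, smul_smul, inv_mul_cancel₀ (by positivity), one_smul]
  have hO := (hs.toOpenPartialHomeomorph s).open_source.mem_nhds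
    hs.mem_toOpenPartialHomeomorph_source
  have hc : Filter.Tendsto g (𝓝 x) (𝓝 x) := by
    simpa [ContinuousAt, hx] using hg.continuousAt
  filter_upwards [h, hO, hc.eventually hO] with y h1 h2 h3
  refine (hs.toOpenPartialHomeomorph s).injOn h3 h2 ?_
  change (m : ℝ)⁻¹ • ∑ i ∈ Finset.range m, g^[i] (g y) =
    (m : ℝ)⁻¹ • ∑ i ∈ Finset.range m, g^[i] y
  congr 1
  -- The sum of `g^[0] y, …, g^[m] y` is split off at its top and at its bottom term; these terms
  -- agree since `g^[m] y = y`.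
  have h4 := Finset.sum_range_succ (fun i => g^[i] y) m
  rw [Finset.sum_range_succ', h1] at h4
  exact add_right_cancel h4

/-- Both derivatives are continuous at `x` and agree at points accumulating at `x`. -/
theorem fderiv_eq_of_frequently {E F : Type*} [NormedAddCommGroup E] [NormedSpace ℝ E]
    [NormedAddCommGroup F] [NormedSpace ℝ F] {f g : E → F} {x : E} (hf : ContDiffAt ℝ 1 f x)
    (hg : ContDiffAt ℝ 1 g x) (h : ∃ᶠ y in 𝓝 x, f =ᶠ[𝓝 y] g) : fderiv ℝ f x = fderiv ℝ g x := by
  have h1 : ContinuousAt (fderiv ℝ f) x := (hf.fderiv_right (m := 0) le_rfl).continuousAt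
  have h2 : ContinuousAt (fderiv ℝ g) x := (hg.fderiv_right (m := 0) le_rfl).continuousAt
  exact tendsto_nhds_unique_of_frequently_eq h1 h2 (h.mono fun y hy => hy.fderiv_eq)

variable {n : ℕ} {M : Type*} [TopologicalSpace M] [T2Space M]
  [ChartedSpace (EuclideanSpace ℝ (Fin n)) M] [IsManifold (𝓡 n) ∞ M]

/-- If a smooth germ agrees with the identity and with a map `g` of finite order arbitrarily close
to `x`, then `g` is the identity near `x`. -/
theorem eventuallyEq_id_of_frequently {f g : M → M} {x : M} (hf : ContMDiffAt (𝓡 n) (𝓡 n) ∞ f x)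
    (hg : ContMDiff (𝓡 n) (𝓡 n) ∞ g) {m : ℕ} (hm : 0 < m) (hgm : g^[m] = id)
    (hfid : ∃ᶠ y in 𝓝 x, f =ᶠ[𝓝 y] id) (hfg : ∃ᶠ y in 𝓝 x, f =ᶠ[𝓝 y] g) : g =ᶠ[𝓝 x] id := by
  have hfx : f x = x :=
    tendsto_nhds_unique_of_frequently_eq hf.continuousAt continuousAt_id (hfid.mono fun y hy => hy.eq_of_nhds)
  have hgx : g x = x := by
    rw [← tendsto_nhds_unique_of_frequently_eq hf.continuousAt hg.continuous.continuousAt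
      (hfg.mono fun y hy => hy.eq_of_nhds), hfx]
  let c := chartAt (EuclideanSpace ℝ (Fin n)) x
  have hxc : x ∈ c.source := mem_chart_source _ x
  have hcx : c.symm (c x) = x := c.left_inv hxc
  have hsymm : Filter.Tendsto c.symm (𝓝 (c x)) (𝓝 x) := by
    have := c.continuousAt_symm (c.map_source hxc)
    rwa [ContinuousAt, hcx] at this
  have hsmooth : ∀ h : M → M, ContMDiffAt (𝓡 n) (𝓡 n) ∞ h x → h x = x →
      ContDiffAt ℝ 1 (c ∘ h ∘ c.symm) (c x) := by
    intro h hh hhx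
    have hc := IsManifold.chart_mem_maximalAtlas (I := 𝓡 n) (n := ∞) x
    have h1 : ContMDiffAt (𝓡 n) (𝓡 n) ∞ c.symm (c x) :=
      contMDiffAt_symm_of_mem_maximalAtlas hc (c.map_source hxc)
    have h2 : ContMDiffAt (𝓡 n) (𝓡 n) ∞ (h ∘ c.symm) (c x) :=
      ContMDiffAt.comp _ (by rwa [hcx]) h1
    have h3 : ContMDiffAt (𝓡 n) (𝓡 n) ∞ (c ∘ h ∘ c.symm) (c x) :=
      ContMDiffAt.comp _ (contMDiffAt_of_mem_maximalAtlas hc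
        (by rwa [Function.comp_apply, hcx, hhx])) h2
    exact h3.contDiffAt.of_le (by simp)
  have hfreq : ∀ h : M → M, (∃ᶠ y in 𝓝 x, f =ᶠ[𝓝 y] h) →
      ∃ᶠ z in 𝓝 (c x), c ∘ f ∘ c.symm =ᶠ[𝓝 z] c ∘ h ∘ c.symm := by
    intro h hh
    refine (c.continuousAt hxc).frequently ?_
    refine (hh.and_eventually (c.open_source.mem_nhds hxc)).mono ?_
    rintro y ⟨hy, hyc⟩
    have := c.continuousAt_symm (c.map_source hyc)
    rw [ContinuousAt, c.left_inv hyc] at this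
    filter_upwards [this.eventually hy] with z hz
    exact congrArg c hz
  have hid : c ∘ id ∘ c.symm =ᶠ[𝓝 (c x)] id := by
    filter_upwards [c.open_target.mem_nhds (c.map_source hxc)] with z hz using c.right_inv hz
  have hfd := hsmooth f hf hfx
  have hgd := hsmooth g hg.contMDiffAt hgx
  -- The germ `f` is the go-between: its derivative at `x` is a limit of derivatives of `g` and also
  -- of derivatives of the identity.
  have hder : fderiv ℝ (c ∘ g ∘ c.symm) (c x) = .id ℝ _ := by
    rw [← fderiv_eq_of_frequently hfd hgd (hfreq g hfg),
      fderiv_eq_of_frequently hfd (hsmooth id contMDiffAt_id rfl) (hfreq id hfid), hid.fderiv_eq,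
      fderiv_id]
  have hstrict := hgd.hasStrictFDerivAt one_ne_zero
  rw [hder] at hstrict
  have hiter : ∀ i : ℕ, (c ∘ g ∘ c.symm)^[i] =ᶠ[𝓝 (c x)] c ∘ g^[i] ∘ c.symm := by
    intro i
    induction i with
    | zero => exact hid.symm
    | succ i ih =>
      have hgi : Filter.Tendsto (g^[i]) (𝓝 x) (𝓝 x) := by
        have := (hg.continuous.iterate i).continuousAt (x := x)
        rwa [ContinuousAt, Function.iterate_fixed hgx] at this
      filter_upwards [ih, (hgi.comp hsymm).eventually (c.open_source.mem_nhds hxc)] with z h1 h2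
      rw [Function.iterate_succ_apply', h1]
      simp only [Function.comp_apply, Function.iterate_succ_apply'] at h2 ⊢
      rw [c.left_inv h2]
  have hG := eventuallyEq_id_of_iterate hstrict
    (by simp only [Function.comp_apply, hcx, hgx]) hm
    ((hiter m).trans (by rw [hgm]; exact hid))
  have hg' : Filter.Tendsto g (𝓝 x) (𝓝 x) := by
    have := hg.continuous.continuousAt (x := x)
    rwa [ContinuousAt, hgx] at this
  filter_upwards [(c.continuousAt hxc).eventually hG, c.open_source.mem_nhds hxc,
    hg'.eventually (c.open_source.mem_nhds hxc)] with y h1 h2 h3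
  rw [Function.comp_apply, Function.comp_apply, c.left_inv h2] at h1
  exact c.injOn h3 h2 h1

end Rigidity

/-! ### Smooth germs along the orbits of a chart -/

namespace OrbifoldChart

variable {n : ℕ} {X : Type u} [TopologicalSpace X] (c : OrbifoldChart.{u, v} n X)

theorem smul_iterate_card (γ : c.group) : (fun p : c.carrier => γ • p)^[Nat.card c.group] = id := by
  rw [smul_iterate, pow_card_eq_one']
  exact funext fun p => one_smul _ p

theorem continuous_smul (γ : c.group) : Continuous fun p : c.carrier => γ • p :=
  (c.contMDiff_smul γ).continuous

/-- An element of the group of a chart which is the identity near a point is trivial. -/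
theorem eq_one_of_eventuallyEq {γ : c.group} {x : c.carrier}
    (h : (fun p : c.carrier => γ • p) =ᶠ[𝓝 x] id) : γ = 1 := by
  -- Closedness is the rigidity statement with `f` and `g` both equal to `γ`; connectedness of the
  -- chart and effectiveness then give `γ = 1`.
  have hclopen : IsClopen {x | (fun p : c.carrier => γ • p) =ᶠ[𝓝 x] id} := by
    refine ⟨isClosed_of_closure_subset fun y hy => ?_, isOpen_setOfPred_eventually_nhds⟩
    exact eventuallyEq_id_of_frequently (c.contMDiff_smul γ).contMDiffAt (c.contMDiff_smul γ)
      Nat.card_pos (c.smul_iterate_card γ) (mem_closure_iff_frequently.1 hy)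
      (Filter.Frequently.of_forall fun _ => .rfl)
  have huniv := hclopen.eq_univ ⟨x, h⟩
  refine eq_of_smul_eq_smul (α := c.carrier) fun p => ?_
  have hp : p ∈ {x | (fun p : c.carrier => γ • p) =ᶠ[𝓝 x] id} := huniv ▸ Set.mem_univ p
  rw [one_smul]
  exact Filter.EventuallyEq.eq_of_nhds hp

/-- Translating by `γ⁻¹` turns the two elements into `1` and `γ⁻¹ * δ`. The latter has finite order,
so rigidity makes it trivial near `x`, hence trivial. -/
theorem eq_of_frequently {f : c.carrier → c.carrier} {x : c.carrier}
    (hf : ContMDiffAt (𝓡 n) (𝓡 n) ∞ f x) {γ δ : c.group}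
    (hγ : ∃ᶠ y in 𝓝 x, f =ᶠ[𝓝 y] fun p => γ • p) (hδ : ∃ᶠ y in 𝓝 x, f =ᶠ[𝓝 y] fun p => δ • p) :
    γ = δ := by
  have h1 : ContMDiffAt (𝓡 n) (𝓡 n) ∞ (fun p => γ⁻¹ • f p) x :=
    (c.contMDiff_smul γ⁻¹).contMDiffAt.comp x hf
  have h2 := eventuallyEq_id_of_frequently h1 (c.contMDiff_smul (γ⁻¹ * δ)) Nat.card_pos
    (c.smul_iterate_card (γ⁻¹ * δ))
    (hγ.mono fun y hy => by
      filter_upwards [hy] with z hz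
      rw [hz, inv_smul_smul, id])
    (hδ.mono fun y hy => by
      filter_upwards [hy] with z hz
      rw [hz, mul_smul])
  exact inv_mul_eq_one.1 (c.eq_one_of_eventuallyEq h2)

/-- A smooth germ which maps every point into its orbit is given by a group element. -/
theorem exists_eventuallyEq_smul {f : c.carrier → c.carrier} {x : c.carrier}
    (hf : ContMDiffAt (𝓡 n) (𝓡 n) ∞ f x) (hfc : ∀ᶠ y in 𝓝 x, ContinuousAt f y)
    (h : ∀ᶠ y in 𝓝 x, ∃ γ : c.group, γ • y = f y) :
    ∃ γ : c.group, f =ᶠ[𝓝 x] fun p => γ • p := by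
  classical
  let _ := Fintype.ofFinite c.group
  let S : c.carrier → Finset c.group := fun y => {γ | γ • y = f y}
  have hS : ∀ y γ, γ ∈ S y ↔ γ • y = f y := fun y γ => by simp [S]
  obtain ⟨O, hO, hOo, hxO⟩ := eventually_nhds_iff.1 (hfc.and h)
  -- By continuity, the set `S` of group elements matching `f` can only shrink under small moves. At
  -- a point where its cardinality is minimal it is locally constant, so each of its elements agrees
  -- with `f` on a neighbourhood.
  have hdense : ∀ y ∈ O, ∃ᶠ z in 𝓝 y, ∃ γ : c.group, f =ᶠ[𝓝 z] fun p => γ • p := by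
    intro y hy
    rw [frequently_nhds_iff]
    intro O' hyO' hO'
    obtain ⟨m, ⟨z, ⟨hzO, hzO'⟩, rfl⟩, hm⟩ := exists_minimal_of_wellFoundedLT
      (fun m : ℕ => ∃ z ∈ O ∩ O', (S z).card = m) ⟨_, y, ⟨hy, hyO'⟩, rfl⟩
    have hz : ∀ w ∈ O ∩ O', (S z).card ≤ (S w).card := fun w hw =>
      (le_total (S w).card (S z).card).elim (fun h => hm ⟨w, hw, rfl⟩ h) id
    obtain ⟨γ, hγ⟩ := (hO z hzO).2
    refine ⟨z, hzO', γ, ?_⟩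
    have hsub : ∀ᶠ w in 𝓝 z, S w ⊆ S z := by
      have : ∀ δ : c.group, ∀ᶠ w in 𝓝 z, δ ∈ S w → δ ∈ S z := by
        intro δ
        by_cases hδ : δ ∈ S z
        · exact Filter.Eventually.of_forall fun _ _ => hδ
        · have hne : δ • z ≠ f z := fun h' => hδ ((hS z δ).2 h')
          have hc := ((c.continuous_smul δ).continuousAt (x := z)).prodMk (hO z hzO).1
          filter_upwards [hc.eventually (isClosed_diagonal.isOpen_compl.mem_nhds hne)] with w hw hw'
          exact (hw ((hS w δ).1 hw')).elim
      filter_upwards [Filter.eventually_all.2 this] with w hw δ hδ using hw δ hδ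
    filter_upwards [hsub, (hOo.inter hO').mem_nhds ⟨hzO, hzO'⟩] with w hw hwO
    have heq : S w = S z := Finset.eq_of_subset_of_card_le hw (hz w hwO)
    have hγw : γ ∈ S w := heq ▸ (hS z γ).2 hγ
    exact ((hS w γ).1 hγw).symm
  -- Since the group is finite, some single element occurs arbitrarily close to `x`.
  obtain ⟨γ, hγ⟩ : ∃ γ : c.group, ∃ᶠ y in 𝓝 x, f =ᶠ[𝓝 y] fun p => γ • p := by
    by_contra! hcon
    refine hdense x hxO ?_
    filter_upwards [Filter.eventually_all.2 hcon] with y hy ⟨γ, hγ⟩ using hy γ hγ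
  refine ⟨γ, ?_⟩
  -- No other element accumulates at `x`, so near `x` the dense set of good points involves `γ`
  -- alone, and continuity gives `f = γ` everywhere near `x`.
  have hall : ∀ᶠ y in 𝓝 x, ∀ δ : c.group, (f =ᶠ[𝓝 y] fun p => δ • p) → δ = γ := by
    refine Filter.eventually_all.2 fun δ => ?_
    by_cases hδ : ∃ᶠ y in 𝓝 x, f =ᶠ[𝓝 y] fun p => δ • p
    · exact Filter.Eventually.of_forall fun _ _ => c.eq_of_frequently hf hδ hγ
    · filter_upwards [Filter.not_frequently.1 hδ] with y hy hy' using (hy hy').elim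
  filter_upwards [eventually_eventually_nhds.2 hall, hOo.mem_nhds hxO] with y hy hyO
  refine tendsto_nhds_unique_of_frequently_eq (hO y hyO).1
    ((c.continuous_smul γ).continuousAt (x := y)) ?_
  refine ((hdense y hyO).and_eventually hy).mono ?_
  rintro z ⟨⟨δ, hδ⟩, hz⟩
  rw [hz δ hδ] at hδ
  exact hδ.eq_of_nhds

end OrbifoldChart

/-! ### Restriction of orbifold charts -/

namespace OrbifoldChart

variable {n : ℕ} {X : Type u} [TopologicalSpace X] (c : OrbifoldChart.{u, v} n X)

theorem isOpenMap_proj : IsOpenMap c.proj := by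
  obtain ⟨e, he⟩ := c.exists_homeomorph
  have : ContinuousConstSMul c.group c.carrier := ⟨c.continuous_smul⟩
  have h : c.proj = (Subtype.val ∘ e) ∘ Quotient.mk _ := funext fun p => (he p).symm
  rw [h]
  exact (c.dom.isOpen.isOpenMap_subtype_val.comp e.isOpenMap).comp isOpenMap_quotient_mk'_mul

theorem proj_mem_dom (p : c.carrier) : c.proj p ∈ c.dom := by
  obtain ⟨e, he⟩ := c.exists_homeomorph
  exact he p ▸ (e _).2

theorem exists_proj_eq {x : X} (hx : x ∈ c.dom) : ∃ p, c.proj p = x := by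
  obtain ⟨e, he⟩ := c.exists_homeomorph
  obtain ⟨a, ha⟩ := e.surjective ⟨x, hx⟩
  induction a using Quotient.inductionOn with
  | h p => exact ⟨p, by rw [← he, ha]⟩

/-- The diffeomorphism given by a group element. -/
def smulDiffeomorph (γ : c.group) : Diffeomorph (𝓡 n) (𝓡 n) c.carrier c.carrier ∞ where
  toFun p := γ • p
  invFun p := γ⁻¹ • p
  left_inv p := inv_smul_smul γ p
  right_inv p := smul_inv_smul γ p
  contMDiff_toFun := c.contMDiff_smul γ
  contMDiff_invFun := c.contMDiff_smul γ⁻¹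

theorem isLocalDiffeomorph_smul (γ : c.group) :
    IsLocalDiffeomorph (𝓡 n) (𝓡 n) ∞ fun p : c.carrier => γ • p :=
  (c.smulDiffeomorph γ).isLocalDiffeomorph

/-- A connected open subset `W` of an orbifold chart together with a subgroup `L` that leaves `W`
invariant, such that the translates of `W` by elements outside of `L` are disjoint from `W`. -/
structure Slice where
  W : TopologicalSpace.Opens c.carrier
  L : Subgroup c.group
  isConnected : IsConnected (W : Set c.carrier)
  smul_mem_iff : ∀ (γ : c.group), ∀ p ∈ W, γ • p ∈ W ↔ γ ∈ L

/-- The whole chart. -/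
def Slice.top : c.Slice where
  W := ⊤
  L := ⊤
  isConnected := isConnected_univ
  smul_mem_iff _ _ _ := ⟨fun _ => trivial, fun _ => trivial⟩

variable {c}

instance Slice.action (s : c.Slice) : MulAction s.L s.W where
  smul δ p := ⟨δ.1 • p.1, (s.smul_mem_iff _ _ p.2).2 δ.2⟩
  one_smul p := Subtype.ext (one_smul c.group p.1)
  mul_smul δ ε p := Subtype.ext (mul_smul δ.1 ε.1 p.1)

variable (c) in
/-- The restriction of an orbifold chart to a slice. -/
def restrict (s : c.Slice) : OrbifoldChart.{u, v} n X where
  carrier := s.W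
  connected := isConnected_iff_connectedSpace.1 s.isConnected
  group := s.L
  effective := ⟨fun {δ ε} h => by
    obtain ⟨x, hx⟩ := s.isConnected.nonempty
    -- Effectiveness survives restriction: an element acting trivially on a nonempty open set is
    -- trivial.
    refine Subtype.ext (inv_mul_eq_one.1 (c.eq_one_of_eventuallyEq (x := x) ?_))
    filter_upwards [s.W.isOpen.mem_nhds hx] with p hp
    have h' : δ.1 • p = ε.1 • p := congrArg Subtype.val (h ⟨p, hp⟩)
    rw [mul_smul, ← h', inv_smul_smul, id]⟩
  contMDiff_smul δ := by
    have h1 : ContMDiff (𝓡 n) (𝓡 n) ∞ fun p : s.W => δ.1 • (p : c.carrier) :=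
      (c.contMDiff_smul δ.1).comp contMDiff_subtype_val
    intro p
    refine (ContMDiffAt.iff_comp_isImmersionAt
      ((IsSmoothEmbedding.of_opens s.W).isImmersion.isImmersionAt _)).2 ⟨?_, h1 p⟩
    exact (h1.continuous.subtype_mk _).continuousAt
  dom := ⟨c.proj '' s.W, c.isOpenMap_proj _ s.W.isOpen⟩
  proj p := c.proj p
  exists_homeomorph := by
    let f : s.W → (⟨c.proj '' s.W, c.isOpenMap_proj _ s.W.isOpen⟩ : TopologicalSpace.Opens X) :=
      fun p => ⟨c.proj p, p, p.2, rfl⟩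
    have hf : Continuous f := (c.continuous_proj.comp continuous_subtype_val).subtype_mk _
    have hfo : IsOpenMap f :=
      (c.isOpenMap_proj.comp s.W.isOpen.isOpenMap_subtype_val).subtype_mk _
    have hinv : ∀ p q : s.W, MulAction.orbitRel s.L s.W p q ↔ f p = f q := by
      intro p q
      rw [MulAction.orbitRel_apply, MulAction.mem_orbit_iff]
      constructor
      · rintro ⟨δ, rfl⟩
        exact Subtype.ext (c.proj_smul δ.1 q.1)
      · intro h
        obtain ⟨γ, hγ⟩ := c.exists_smul_eq (congrArg Subtype.val h).symm
        exact ⟨⟨γ, (s.smul_mem_iff γ q q.2).1 (hγ ▸ p.2)⟩, Subtype.ext hγ⟩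
    let e : MulAction.orbitRel.Quotient s.L s.W ≃
        (⟨c.proj '' s.W, c.isOpenMap_proj _ s.W.isOpen⟩ : TopologicalSpace.Opens X) :=
      Equiv.ofBijective (Quotient.lift f fun p q h => (hinv p q).1 h) (by
        constructor
        · intro a b
          induction a, b using Quotient.inductionOn₂
          exact fun h => Quotient.sound ((hinv _ _).2 h)
        · rintro ⟨y, p, hp, h⟩
          exact ⟨Quotient.mk _ ⟨p, hp⟩, Subtype.ext h⟩)
    refine ⟨e.toHomeomorphOfContinuousOpen (continuous_quot_lift _ hf) fun S hS => ?_,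
      fun _ => rfl⟩
    convert hfo _ (hS.preimage continuous_quot_mk) using 1
    ext y
    constructor
    · rintro ⟨a, ha, rfl⟩
      induction a using Quotient.inductionOn with
      | h p => exact ⟨p, ha, rfl⟩
    · rintro ⟨p, hp, rfl⟩
      exact ⟨Quotient.mk _ p, hp, rfl⟩

/-- Every point of an orbifold chart has arbitrarily small slices. -/
theorem exists_slice (x : c.carrier) {O : Set c.carrier} (hO : O ∈ 𝓝 x) :
    ∃ s : c.Slice, x ∈ s.W ∧ (s.W : Set c.carrier) ⊆ O ∧ s.L = MulAction.stabilizer c.group x := by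
  have hsep : ∀ γ : c.group, ∃ U ∈ 𝓝 x, ∀ p ∈ U, γ • p ∈ U → γ • x = x := by
    intro γ
    by_cases h : γ • x = x
    · exact ⟨Set.univ, Filter.univ_mem, fun _ _ _ => h⟩
    · obtain ⟨U, V, hU, hV, hxU, hxV, hd⟩ := t2_separation h
      refine ⟨V ∩ (fun p => γ • p) ⁻¹' U, Filter.inter_mem (hV.mem_nhds hxV)
        ((c.continuous_smul γ).continuousAt (hU.mem_nhds hxU)), fun p hp hp' => ?_⟩
      exact (Set.disjoint_left.1 hd hp.2 hp'.1).elim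
  choose U hU hUsep using hsep
  obtain ⟨O', hO', hO'o, hxO'⟩ := mem_nhds_iff.1
    (Filter.inter_mem hO (Filter.iInter_mem.2 hU))
  -- Intersecting over the stabilizer makes the neighbourhood invariant. The slice is its connected
  -- component at `x`, which stays invariant because the stabilizer fixes `x`.
  let O₂ : Set c.carrier := ⋂ δ : MulAction.stabilizer c.group x, (fun p => δ.1 • p) ⁻¹' O'
  have hO₂ : IsOpen O₂ := isOpen_iInter_of_finite fun δ => hO'o.preimage (c.continuous_smul δ.1)
  have hxO₂ : x ∈ O₂ := Set.mem_iInter.2 fun δ => by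
    rw [Set.mem_preimage, MulAction.mem_stabilizer_iff.1 δ.2]
    exact hxO'
  have hO₂' : O₂ ⊆ O' := fun p hp => by
    have := Set.mem_iInter.1 hp 1
    rwa [Set.mem_preimage, OneMemClass.coe_one, one_smul] at this
  have hinv : ∀ δ ∈ MulAction.stabilizer c.group x, ∀ p ∈ O₂, δ • p ∈ O₂ := by
    intro δ hδ p hp
    refine Set.mem_iInter.2 fun ε => ?_
    have := Set.mem_iInter.1 hp (ε * ⟨δ, hδ⟩)
    rwa [Set.mem_preimage, Subgroup.coe_mul, mul_smul] at this
  have : LocallyConnectedSpace c.carrier :=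
    ChartedSpace.locallyConnectedSpace (EuclideanSpace ℝ (Fin n)) _
  have hsub := connectedComponentIn_subset O₂ x
  have hconn := isConnected_connectedComponentIn_iff.2 hxO₂
  refine ⟨⟨⟨connectedComponentIn O₂ x, hO₂.connectedComponentIn⟩, MulAction.stabilizer c.group x,
    hconn, fun γ p hp => ⟨fun h => ?_, fun h => ?_⟩⟩, mem_connectedComponentIn hxO₂,
    fun p hp => (hO' (hO₂' (hsub hp))).1, rfl⟩
  · have h1 := Set.mem_iInter.1 (hO' (hO₂' (hsub hp))).2 γ
    have h2 := Set.mem_iInter.1 (hO' (hO₂' (hsub h))).2 γ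
    exact hUsep γ p h1 h2
  · have h1 : IsPreconnected ((fun p => γ • p) '' connectedComponentIn O₂ x) :=
      hconn.isPreconnected.image _ (c.continuous_smul γ).continuousOn
    have h2 := h1.subset_connectedComponentIn (x := x)
      ⟨x, mem_connectedComponentIn hxO₂, MulAction.mem_stabilizer_iff.1 h⟩
      (by rintro _ ⟨q, hq, rfl⟩; exact hinv γ h q (hsub hq))
    exact h2 ⟨p, hp, rfl⟩

end OrbifoldChart

namespace IsInjection

variable {n : ℕ} {X : Type u} [TopologicalSpace X] {c d : OrbifoldChart.{u, v} n X}
  {f : c.carrier → d.carrier}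

theorem refl (c : OrbifoldChart.{u, v} n X) : IsInjection c c id where
  isSmoothEmbedding := .id
  proj_apply _ := rfl

theorem smul (hf : IsInjection c d f) (γ : d.group) : IsInjection c d fun p => γ • f p where
  isSmoothEmbedding := by
    have hemb : Topology.IsEmbedding fun p => γ • f p :=
      (d.smulDiffeomorph γ).toHomeomorph.isEmbedding.comp hf.isSmoothEmbedding.isEmbedding
    refine ⟨isImmersion_of_isLocalDiffeomorph_comp ?_ (d.isLocalDiffeomorph_smul γ⁻¹)
      hemb.continuous, hemb⟩
    rw [show (fun p => γ⁻¹ • p) ∘ (fun p => γ • f p) = f from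
      funext fun p => inv_smul_smul γ (f p)]
    exact hf.isSmoothEmbedding.isImmersion
  proj_apply p := by rw [d.proj_smul, hf.proj_apply]

theorem restrict (hf : IsInjection c d f) (s : c.Slice) :
    IsInjection (c.restrict s) d fun p : s.W => f p where
  isSmoothEmbedding :=
    ⟨isImmersion_comp_isLocalDiffeomorph hf.isSmoothEmbedding.isImmersion
      (isLocalDiffeomorph_opens_val s.W),
      hf.isSmoothEmbedding.isEmbedding.comp .subtypeVal⟩
  proj_apply := fun p : s.W => hf.proj_apply p

theorem codRestrict (hf : IsInjection c d f) (t : d.Slice) (h : ∀ p, f p ∈ t.W) :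
    IsInjection c (d.restrict t) fun p => (⟨f p, h p⟩ : t.W) where
  isSmoothEmbedding := by
    have hemb : Topology.IsEmbedding fun p => (⟨f p, h p⟩ : t.W) :=
      hf.isSmoothEmbedding.isEmbedding.codRestrict _ h
    exact ⟨isImmersion_of_isLocalDiffeomorph_comp (b := (Subtype.val : t.W → d.carrier))
      hf.isSmoothEmbedding.isImmersion
      (isLocalDiffeomorph_opens_val t.W) hemb.continuous, hemb⟩
  proj_apply p := hf.proj_apply p

end IsInjection

/-! ### Restrictions of charts belong to a maximal atlas -/

section Atlas

variable {n : ℕ} {X : Type u} [TopologicalSpace X]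

theorem Compatible.symm {c d : OrbifoldChart.{u, v} n X} (h : Compatible c d) :
    Compatible d c := by
  intro x hx
  obtain ⟨W, hxW, hW, hf, hg⟩ := h x hx.symm
  exact ⟨W, hxW, fun y hy => (hW hy).symm, hg, hf⟩

theorem Compatible.refl (c : OrbifoldChart.{u, v} n X) : Compatible c c :=
  fun _ hx => ⟨c, hx.1, fun _ hy => ⟨hy, hy⟩, ⟨_, .refl c⟩, ⟨_, .refl c⟩⟩

/-- A common chart `Z` may inject into a different translate of the slice. Composing with a group
element moves a point over `x` into `s.W`, and shrinking `Z` to a slice of its own keeps the whole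
image there. -/
theorem Compatible.restrict {c d : OrbifoldChart.{u, v} n X} (h : Compatible c d) (s : c.Slice) :
    Compatible (c.restrict s) d := by
  rintro _ ⟨⟨p, hp, rfl⟩, hxd⟩
  obtain ⟨Z, hxZ, hZ, ⟨f, hf⟩, ⟨g, hg⟩⟩ := h (c.proj p) ⟨c.proj_mem_dom p, hxd⟩
  obtain ⟨z, hz⟩ := Z.exists_proj_eq hxZ
  obtain ⟨γ, hγ⟩ := c.exists_smul_eq ((hf.proj_apply z).trans hz)
  have hf' := hf.smul γ
  obtain ⟨t, hzt, ht, -⟩ := OrbifoldChart.exists_slice z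
    (hf'.isSmoothEmbedding.isEmbedding.continuous.continuousAt
      (s.W.isOpen.mem_nhds (x := γ • f z) (by rw [hγ]; exact hp)))
  refine ⟨Z.restrict t, ⟨z, hzt, hz⟩, ?_, ⟨_, (hf'.restrict t).codRestrict s fun p => ht p.2⟩,
    ⟨_, hg.restrict t⟩⟩
  rintro _ ⟨q, hq, rfl⟩
  refine ⟨⟨γ • f q, ht hq, hf'.proj_apply q⟩, (hZ (Z.proj_mem_dom q)).2⟩

/-- A maximal atlas contains the restrictions of its charts to slices. -/
theorem IsMaximalAtlas.restrict_mem {𝒜 : Set (OrbifoldChart.{u, v} n X)} (h𝒜 : IsMaximalAtlas 𝒜)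
    {c : OrbifoldChart.{u, v} n X} (hc : c ∈ 𝒜) (s : c.Slice) : c.restrict s ∈ 𝒜 := by
  have h : IsAtlas (insert (c.restrict s) 𝒜) := by
    refine ⟨?_, fun x => ?_⟩
    · rintro d (rfl | hd) e (rfl | he)
      · exact .refl _
      · exact (h𝒜.prop.compatible c hc e he).restrict s
      · exact ((h𝒜.prop.compatible c hc d hd).restrict s).symm
      · exact h𝒜.prop.compatible d hd e he
    · obtain ⟨d, hd, hxd⟩ := h𝒜.prop.exists_mem x
      exact ⟨d, Set.mem_insert_of_mem _ hd, hxd⟩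
  exact h𝒜.le_of_ge h (Set.subset_insert _ _) (Set.mem_insert _ _)

end Atlas

/-! ### Groupoid embeddings in small slices -/

namespace OrbifoldChart

variable {n : ℕ} {X : Type u} [TopologicalSpace X] (c : OrbifoldChart.{u, v} n X)

theorem isTransition_smul (γ : c.group) :
    IsTransition n c.proj (c.smulDiffeomorph γ).toHomeomorph.toOpenPartialHomeomorph where
  contMDiffOn := (c.contMDiff_smul γ).contMDiffOn
  contMDiffOn_symm := (c.contMDiff_smul γ⁻¹).contMDiffOn
  proj_apply p _ := c.proj_smul γ p

/-- The germ of a group element. -/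
def germ (γ : c.group) (p : c.carrier) : Arrow n c.proj :=
  .mk _ (c.isTransition_smul γ) p trivial

theorem continuous_germ (γ : c.group) : Continuous (c.germ γ) :=
  (Arrow.continuous_mk _ (c.isTransition_smul γ)).comp
    (Continuous.subtype_mk continuous_id fun _ => trivial)

/-- All arrows of the groupoid of a chart are germs of group elements. -/
theorem exists_eq_germ (α : Arrow n c.proj) : ∃ γ : c.group, α = c.germ γ α.src := by
  obtain ⟨f, hf, p, hp, rfl⟩ := α.exists_eq_mk
  have hO := f.open_source.mem_nhds hp
  obtain ⟨γ, hγ⟩ := c.exists_eventuallyEq_smul (hf.contMDiffOn.contMDiffAt hO)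
    (by filter_upwards [hO] with y hy using f.continuousAt hy)
    (by
      filter_upwards [hO] with y hy
      exact c.exists_smul_eq (hf.proj_apply y hy).symm)
  exact ⟨γ, Arrow.mk_eq_mk.2 ⟨rfl, hγ⟩⟩

end OrbifoldChart

section LocalModel

variable {n : ℕ} {X : Type u} [TopologicalSpace X] {ι : Type*} (A : ι → OrbifoldChart.{u, v} n X)

theorem isLocalDiffeomorph_objectsMk (i : ι) :
    IsLocalDiffeomorph (𝓡 n) (𝓡 n) ∞ (fun p => ⟨i, p⟩ : (A i).carrier → Objects A) :=
  isLocalDiffeomorph_sigmaMk (Q := fun i => (A i).carrier) i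

/-- A slice in a chart of the family `A` and an open connected set `S` whose image under `ψ` is a
closed subset of the slice on which the orbits of the group of the slice are orbits of the
elements that leave the image of `S` invariant. -/
structure LocalModel {N : Type*} [TopologicalSpace N] (ψ : N → Objects A) where
  i : ι
  slice : (A i).Slice
  S : Set N
  isOpen : IsOpen S
  isPreconnected : IsPreconnected S
  exists_eq : ∀ z ∈ S, ∃ p : slice.W, ψ z = ⟨i, p⟩
  isClosed : IsClosed {p : slice.W | ∃ z ∈ S, ψ z = ⟨i, p⟩}
  exists_smul : ∀ (γ : slice.L) (p : slice.W), (∃ z ∈ S, ψ z = ⟨i, p⟩) →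
    (∃ z ∈ S, ψ z = ⟨i, (γ • p : slice.W)⟩) →
    ∃ δ : slice.L, (∀ q : slice.W, (∃ z ∈ S, ψ z = ⟨i, (δ • q : slice.W)⟩) ↔
      ∃ z ∈ S, ψ z = ⟨i, q⟩) ∧ δ • p = γ • p

/-- The local model given by a whole chart and the empty set. -/
def LocalModel.top {N : Type*} [TopologicalSpace N] (ψ : N → Objects A) (i : ι) :
    LocalModel A ψ where
  i := i
  slice := .top _
  S := ∅
  isOpen := isOpen_empty
  isPreconnected := isPreconnected_empty
  exists_eq _ h := h.elim
  isClosed := by simp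
  exists_smul := by simp

variable {A} {k : ℕ} {Y : Set X} {κ : Type*} {B : κ → OrbifoldChart.{u, v} k Y}

/-- A groupoid embedding is equivariant near every point, for the isotropy group. -/
theorem exists_eventually_obj_smul (Φ : GroupoidEmbedding k n (totalProj B) (totalProj A))
    {j : κ} {y : (B j).carrier} {i : ι} {x : (A i).carrier} (hx : Φ.obj ⟨j, y⟩ = ⟨i, x⟩)
    {δ : (B j).group} (hδ : δ • y = y) :
    ∃ γ : (A i).group, ∀ᶠ z in 𝓝 y, ∀ p : (A i).carrier, Φ.obj ⟨j, z⟩ = ⟨i, p⟩ →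
      Φ.obj ⟨j, δ • z⟩ = ⟨i, γ • p⟩ := by
  have hj := isLocalDiffeomorph_objectsMk B j
  have hi := isLocalDiffeomorph_objectsMk A i
  have hρ : ∀ z, totalProj B ⟨j, z⟩ = (B j).proj z := fun _ => rfl
  have hπ : ∀ z, totalProj A ⟨i, z⟩ = (A i).proj z := fun _ => rfl
  let α : (B j).carrier → Arrow n (totalProj A) := fun z => Φ.arr (((B j).germ δ z).push hj hρ)
  have hα : Continuous α := Φ.arr_isSmoothEmbedding.isEmbedding.continuous.comp
    ((Arrow.continuous_push hj hρ).comp ((B j).continuous_germ δ))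
  have hsrc : ∀ z, (α z).src = Φ.obj ⟨j, z⟩ := fun z => by
    rw [Φ.src_arr, Arrow.src_push]
    rfl
  have htgt : ∀ z, (α z).tgt = Φ.obj ⟨j, δ • z⟩ := fun z => by
    rw [Φ.tgt_arr, Arrow.tgt_push]
    rfl
  -- At `z = y` the arrow `α z` goes from `x` to itself, so it lifts to the groupoid of the single
  -- chart `A i`, where it is the germ of some `γ`.
  obtain ⟨β, hβ1, -, hβ3⟩ := Arrow.exists_push_eq hi hπ x x (α y) ((hsrc y).trans hx)
    (by rw [htgt, hδ, hx])
  obtain ⟨γ, hγ⟩ := (A i).exists_eq_germ β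
  rw [hβ1] at hγ
  subst hγ
  refine ⟨γ, ?_⟩
  -- Arrows near `α y` are germs of one transition `g`, which coincides with `γ` near `x`.
  have key : ∀ᶠ α' in 𝓝 (α y), ∀ p : (A i).carrier, α'.src = ⟨i, p⟩ → α'.tgt = ⟨i, γ • p⟩ := by
    obtain ⟨g, hg, q, hq, hgq⟩ := (α y).exists_eq_mk
    rw [hgq]
    rw [hgq] at hβ3
    obtain ⟨rfl, hg2⟩ := (Arrow.push_mk_eq hi hπ).1 hβ3
    refine Arrow.eventually_nhds_mk.2 ?_
    rw [Sigma.nhds_mk, Filter.eventually_map]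
    filter_upwards [hg2] with p hp _ p' hp'
    obtain rfl : p = p' := eq_of_heq (Sigma.mk.inj hp').2
    exact hp.symm
  filter_upwards [hα.continuousAt.eventually key] with z hz p hp
  rw [← htgt]
  exact hz p ((hsrc z).trans hp)

/-- Every point has a local model, for the object map of a groupoid embedding over the identity. -/
theorem exists_localModel (Φ : GroupoidEmbedding k n (totalProj B) (totalProj A))
    (hΦ : ∀ p, totalProj A (Φ.obj p) = ((totalProj B p : Y) : X)) (p : Objects B) :
    ∃ D : LocalModel A Φ.obj, p ∈ D.S := by
  obtain ⟨j, y⟩ := p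
  obtain ⟨i, x, hx⟩ : ∃ i, ∃ x : (A i).carrier, Φ.obj ⟨j, y⟩ = ⟨i, x⟩ := ⟨_, _, rfl⟩
  have hequiv : ∀ δ : (B j).group, ∃ γ : (A i).group, δ • y = y → ∀ᶠ z in 𝓝 y,
      ∀ p : (A i).carrier, Φ.obj ⟨j, z⟩ = ⟨i, p⟩ → Φ.obj ⟨j, δ • z⟩ = ⟨i, γ • p⟩ := by
    intro δ
    by_cases hδ : δ • y = y
    · obtain ⟨γ, hγ⟩ := exists_eventually_obj_smul Φ hx hδ
      exact ⟨γ, fun _ => hγ⟩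
    · exact ⟨1, fun h => (hδ h).elim⟩
  choose θ hθ using hequiv
  have hO : ∀ᶠ z in 𝓝 y, ∀ δ : (B j).group, δ • y = y → ∀ p : (A i).carrier,
      Φ.obj ⟨j, z⟩ = ⟨i, p⟩ → Φ.obj ⟨j, δ • z⟩ = ⟨i, θ δ • p⟩ :=
    Filter.eventually_all.2 fun δ => by
      by_cases hδ : δ • y = y
      · filter_upwards [hθ δ hδ] with z hz _ using hz
      · exact Filter.Eventually.of_forall fun _ h => (hδ h).elim
  have hθx : ∀ δ : (B j).group, δ • y = y → θ δ • x = x := by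
    intro δ hδ
    have h := hO.self_of_nhds δ hδ x hx
    rw [hδ, hx] at h
    exact (eq_of_heq (Sigma.mk.inj h).2).symm
  obtain ⟨t, hyt, htO, htL⟩ := OrbifoldChart.exists_slice y hO
  have hlc : LocallyCompactSpace (B j).carrier :=
    ChartedSpace.locallyCompactSpace (EuclideanSpace ℝ (Fin k)) _
  have hlconn : LocallyConnectedSpace (B j).carrier :=
    ChartedSpace.locallyConnectedSpace (EuclideanSpace ℝ (Fin k)) _
  obtain ⟨K, hKy, hKt, hK⟩ := local_compact_nhds (t.W.isOpen.mem_nhds hyt)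
  let ψ : (B j).carrier → Objects A := fun z => Φ.obj ⟨j, z⟩
  have hψ : Topology.IsEmbedding ψ :=
    Φ.obj_isSmoothEmbedding.isEmbedding.comp Topology.IsEmbedding.sigmaMk
  -- This is where the embedding property enters: no part of the image of `ψ` from outside `K` can
  -- return close to `x`, so a slice `s` inside `O` has its whole preimage `N₁` in the compact set
  -- `K`.
  obtain ⟨O, hOo, hOK⟩ := hψ.isInducing.isOpen_iff.1 (isOpen_interior (s := K))
  have hxO : (⟨i, x⟩ : Objects A) ∈ O := by
    rw [← hx]
    exact hOK.symm.subset (mem_interior_iff_mem_nhds.2 hKy)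
  have hmk : Continuous (fun p => ⟨i, p⟩ : (A i).carrier → Objects A) :=
    continuous_sigmaMk (σ := fun i => (A i).carrier)
  obtain ⟨s, hxs, hsO, hsL⟩ := OrbifoldChart.exists_slice x
    (hmk.continuousAt (hOo.mem_nhds hxO))
  have hθL : ∀ δ : (B j).group, δ • y = y → θ δ ∈ s.L := fun δ hδ => by
    rw [hsL]
    exact hθx δ hδ
  let N₁ : Set (B j).carrier := ψ ⁻¹' (Sigma.mk i '' (s.W : Set (A i).carrier))
  have hN₁o : IsOpen N₁ := 
    (isOpenMap_sigmaMk (σ := fun i => (A i).carrier) _ s.W.isOpen).preimage hψ.continuous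
  have hyN₁ : y ∈ N₁ := ⟨x, hxs, hx.symm⟩
  have hN₁K : N₁ ⊆ K := by
    rintro z ⟨p, hp, hpz⟩
    refine interior_subset (hOK.subset ?_)
    rw [Set.mem_preimage, ← hpz]
    exact hsO hp
  have hN₁ : ∀ z ∈ N₁, ∀ δ : (B j).group, δ • y = y → ∀ p : (A i).carrier,
      ψ z = ⟨i, p⟩ → ψ (δ • z) = ⟨i, θ δ • p⟩ := fun z hz => htO (hKt (hN₁K hz))
  let S : Set (B j).carrier := connectedComponentIn N₁ y
  have hSN : S ⊆ N₁ := connectedComponentIn_subset _ _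
  have hyS : y ∈ S := mem_connectedComponentIn hyN₁
  have hSconn : IsPreconnected S := isPreconnected_connectedComponentIn
  have hSinv : ∀ δ : (B j).group, δ • y = y → ∀ z ∈ S, δ • z ∈ S := by
    intro δ hδ z hz
    refine (hSconn.image _ ((B j).continuous_smul δ).continuousOn).subset_connectedComponentIn
      ⟨y, hyS, hδ⟩ ?_ ⟨z, hz, rfl⟩
    rintro _ ⟨z', hz', rfl⟩
    obtain ⟨p, hp, hpz⟩ := hSN hz'
    exact ⟨θ δ • p, (s.smul_mem_iff _ p hp).2 (hθL δ hδ), (hN₁ z' (hSN hz') δ hδ p hpz.symm).symm⟩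
  -- A connected component is relatively closed in `N₁`.
  have hScl : N₁ ∩ closure S ⊆ S :=
    (hSconn.subset_closure (Set.subset_inter hSN subset_closure) Set.inter_subset_right).subset_connectedComponentIn ⟨hyN₁, subset_closure hyS⟩
      Set.inter_subset_left
  have himage : ∀ q : Objects A, (∃ z ∈ Sigma.mk j '' S, Φ.obj z = q) ↔ ∃ z ∈ S, ψ z = q :=
    fun q => ⟨fun ⟨_, ⟨z, hz, rfl⟩, h⟩ => ⟨z, hz, h⟩, fun ⟨z, hz, h⟩ => ⟨_, ⟨z, hz, rfl⟩, h⟩⟩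
  refine ⟨⟨i, s, Sigma.mk j '' S, isOpenMap_sigmaMk _ hN₁o.connectedComponentIn,
    hSconn.image _ continuous_sigmaMk.continuousOn, ?_, ?_, ?_⟩, y, hyS, rfl⟩
  · rintro _ ⟨z, hz, rfl⟩
    obtain ⟨p, hp, hpz⟩ := hSN hz
    exact ⟨⟨p, hp⟩, hpz.symm⟩
  -- The image of `S` is the trace on the slice of a compact set, by `hScl` and `N₁ ⊆ K`.
  · have hcl : IsClosed (ψ '' (K ∩ closure S)) :=
      ((hK.inter_right isClosed_closure).image hψ.continuous).isClosed
    convert hcl.preimage (hmk.comp (continuous_subtype_val (p := (· ∈ s.W)))) using 1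
    ext p
    refine (himage _).trans ⟨?_, ?_⟩
    · rintro ⟨z, hz, hzp⟩
      exact ⟨z, ⟨hN₁K (hSN hz), subset_closure hz⟩, hzp⟩
    · rintro ⟨z, ⟨-, hz⟩, hzp⟩
      exact ⟨z, hScl ⟨⟨p, p.2, hzp.symm⟩, hz⟩, hzp⟩
  · simp only [himage]
    rintro γ p ⟨z, hz, hzp⟩ ⟨z', hz', hzp'⟩
    -- Points in one orbit of the ambient chart have the same image in `X`; as `Φ` covers the
    -- identity, `z` and `z'` have the same image in `Y` and so differ by some `δ`. Both lie in the
    -- slice `t`, so `δ` fixes `y`.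
    have hproj : (B j).proj z = (B j).proj z' := by
      refine Subtype.ext ?_
      have h1 := hΦ ⟨j, z⟩
      have h2 := hΦ ⟨j, z'⟩
      rw [show Φ.obj ⟨j, z⟩ = _ from hzp] at h1
      rw [show Φ.obj ⟨j, z'⟩ = _ from hzp'] at h2
      exact h1.symm.trans (((A i).proj_smul γ.1 p.1).symm.trans h2)
    obtain ⟨δ, rfl⟩ := (B j).exists_smul_eq hproj
    have hδ : δ • y = y := by
      have : δ ∈ t.L := (t.smul_mem_iff δ z (hKt (hN₁K (hSN hz)))).1 (hKt (hN₁K (hSN hz')))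
      rwa [htL] at this
    refine ⟨⟨θ δ, hθL δ hδ⟩, fun q => ⟨?_, ?_⟩, ?_⟩
    · rintro ⟨z₁, hz₁, hzq⟩
      -- Multiplicativity of `θ` is not available, so the inverse is taken in the group of `B j` and
      -- equivariance under `δ` is applied at `δ⁻¹ • z₁`.
      have hδ' : δ⁻¹ • y = y := inv_smul_eq_iff.2 hδ.symm
      have hz₂ := hSinv δ⁻¹ hδ' z₁ hz₁
      obtain ⟨q', hq', hqz⟩ := hSN hz₂
      have h := hN₁ _ (hSN hz₂) δ hδ q' hqz.symm
      rw [smul_inv_smul, hzq] at h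
      have h' : θ δ • q.1 = θ δ • q' := eq_of_heq (Sigma.mk.inj h).2
      exact ⟨_, hz₂, by rw [← hqz, smul_left_cancel _ h']⟩
    · rintro ⟨z₁, hz₁, hzq⟩
      exact ⟨δ • z₁, hSinv δ hδ z₁ hz₁, hN₁ z₁ (hSN hz₁) δ hδ q hzq⟩
    · have h := hN₁ z (hSN hz) δ hδ p hzp
      rw [hzp'] at h
      exact Subtype.ext (eq_of_heq (Sigma.mk.inj h).2).symm

end LocalModel

/-! ### The suborbifold cover given by a family of local models -/

section Refinement

variable {n k : ℕ} {X : Type u} [TopologicalSpace X] {Y : Set X} {ι κ : Type*}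
  {A : ι → OrbifoldChart.{u, v} n X} {B : κ → OrbifoldChart.{u, v} k Y}
  {Φ : GroupoidEmbedding k n (totalProj B) (totalProj A)}

theorem isOpenMap_totalProj : IsOpenMap (totalProj B) :=
  isOpenMap_sigma.2 fun j => (B j).isOpenMap_proj

namespace LocalModel

variable (D : LocalModel A Φ.obj)

/-- The chart given by the slice of a local model. -/
def chart : OrbifoldChart.{u, v} n X := (A D.i).restrict D.slice

/-- The inclusion of the slice of a local model. -/
def chartIncl (p : D.chart.carrier) : Objects A := ⟨D.i, (show D.slice.W from p).1⟩

theorem isLocalDiffeomorph_chartIncl : IsLocalDiffeomorph (𝓡 n) (𝓡 n) ∞ D.chartIncl :=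
  isLocalDiffeomorph_comp (isLocalDiffeomorph_objectsMk A D.i)
    (isLocalDiffeomorph_opens_val D.slice.W)

theorem isEmbedding_chartIncl : Topology.IsEmbedding D.chartIncl :=
  (Topology.IsEmbedding.sigmaMk (σ := fun i => (A i).carrier)).comp .subtypeVal

/-- The submanifold of the slice of a local model. -/
def V : Set D.chart.carrier := {p | ∃ z ∈ D.S, Φ.obj z = D.chartIncl p}

/-- The inverse of the object map on the submanifold. -/
def toObjects (p : D.V) : Objects B := p.2.choose

theorem toObjects_mem (p : D.V) : D.toObjects p ∈ D.S := p.2.choose_spec.1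

theorem obj_toObjects (p : D.V) : Φ.obj (D.toObjects p) = D.chartIncl p := p.2.choose_spec.2

theorem range_toObjects : Set.range D.toObjects = D.S := by
  ext z
  constructor
  · rintro ⟨p, rfl⟩
    exact D.toObjects_mem p
  · intro hz
    obtain ⟨p, hp⟩ := D.exists_eq z hz
    exact ⟨⟨p, z, hz, hp⟩, Φ.obj_isSmoothEmbedding.isEmbedding.injective
      ((D.obj_toObjects _).trans hp.symm)⟩

/-- After composition with the embedding `Φ.obj` this map becomes the inclusion of the submanifold,
and its range is the open set `D.S`. -/
theorem isOpenEmbedding_toObjects : Topology.IsOpenEmbedding D.toObjects := by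
  refine ⟨?_, D.range_toObjects ▸ D.isOpen⟩
  rw [← Φ.obj_isSmoothEmbedding.isEmbedding.of_comp_iff,
    show Φ.obj ∘ D.toObjects = D.chartIncl ∘ Subtype.val from funext D.obj_toObjects]
  exact D.isEmbedding_chartIncl.comp .subtypeVal

/-- The smooth structure is transported from `D.S`, so the inclusion of `D.V` is locally `Φ.obj` up
to local diffeomorphisms, hence an immersion. -/
instance : ChartedSpace (EuclideanSpace ℝ (Fin k)) D.V :=
  etaleChartedSpace D.isOpenEmbedding_toObjects.isLocalHomeomorph

instance : IsManifold (𝓡 k) ∞ D.V :=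
  etaleIsManifold D.isOpenEmbedding_toObjects.isLocalHomeomorph

theorem isLocalDiffeomorph_toObjects : IsLocalDiffeomorph (𝓡 k) (𝓡 k) ∞ D.toObjects :=
  isLocalDiffeomorph_etale D.isOpenEmbedding_toObjects.isLocalHomeomorph

theorem isSmoothEmbedding_val :
    IsSmoothEmbedding (𝓡 k) (𝓡 n) ∞ (Subtype.val : D.V → D.chart.carrier) := by
  refine ⟨isImmersion_of_isLocalDiffeomorph_comp ?_ D.isLocalDiffeomorph_chartIncl
    continuous_subtype_val, .subtypeVal⟩
  rw [show D.chartIncl ∘ Subtype.val = Φ.obj ∘ D.toObjects from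
    funext fun p => (D.obj_toObjects p).symm]
  exact isImmersion_comp_isLocalDiffeomorph Φ.obj_isSmoothEmbedding.isImmersion
    D.isLocalDiffeomorph_toObjects

theorem isPreconnected_V : IsPreconnected D.V := by
  have h : IsPreconnected (Set.univ : Set D.V) := by
    rw [← D.isOpenEmbedding_toObjects.isInducing.isPreconnected_image, Set.image_univ,
      D.range_toObjects]
    exact D.isPreconnected
  have := h.image _ continuous_subtype_val.continuousOn
  rwa [Set.image_univ, Subtype.range_val] at this

/-- The subgroup that leaves the submanifold invariant. -/
def Δ : Subgroup D.chart.group where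
  carrier := {δ | ∀ p, δ • p ∈ D.V ↔ p ∈ D.V}
  one_mem' p := by rw [one_smul]
  mul_mem' hδ hε p := by rw [mul_smul, hδ, hε]
  inv_mem' hδ p := by rw [← hδ, smul_inv_smul]

theorem isSubgroupSet : IsSubgroupSet D.Δ D.V where
  smul_mem _ hδ p hp := (hδ p).2 hp
  exists_smul_eq γ p hp hγp := D.exists_smul γ p hp hγp

theorem proj_image_V (hΦ : ∀ p, totalProj A (Φ.obj p) = ((totalProj B p : Y) : X)) :
    D.chart.proj '' D.V = (fun z => ((totalProj B z : Y) : X)) '' D.S := by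
  ext x
  constructor
  · rintro ⟨p, ⟨z, hz, hzp⟩, rfl⟩
    refine ⟨z, hz, ?_⟩
    change ((totalProj B z : Y) : X) = _
    rw [← hΦ, hzp]
    rfl
  · rintro ⟨z, hz, rfl⟩
    obtain ⟨p, hp⟩ := D.exists_eq z hz
    refine ⟨p, ⟨z, hz, hp⟩, ?_⟩
    change _ = ((totalProj B z : Y) : X)
    rw [← hΦ, hp]
    rfl

end LocalModel

variable (hΦ : ∀ p, totalProj A (Φ.obj p) = ((totalProj B p : Y) : X)) {T : Type w}
  (D : T → LocalModel A Φ.obj) (hD : ∀ y : Y, ∃ t, ∃ z ∈ (D t).S, totalProj B z = y)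

/-- The suborbifold cover by the submanifolds of a family of local models. -/
def localModelCover : SuborbifoldCover k (fun t => (D t).chart) Y where
  -- Models with empty `S` contribute a chart but no submanifold, since submanifolds of a cover must
  -- be nonempty.
  J := {t | (D t).S.Nonempty}
  V j := (D j).V
  charted j := inferInstance
  isManifold j := inferInstance
  isSmoothEmbedding j := (D j).isSmoothEmbedding_val
  isConnected j := by
    refine ⟨?_, (D j).isPreconnected_V⟩
    obtain ⟨z, hz⟩ := j.2
    rw [← (D j).range_toObjects] at hz
    obtain ⟨p, -⟩ := hz
    exact ⟨p, p.2⟩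
  Δ j := (D j).Δ
  isSubgroupSet j := (D j).isSubgroupSet
  isOpen_image j := by
    convert isOpenMap_totalProj (B := B) _ (D j).isOpen using 1
    rw [(D j).proj_image_V hΦ, ← Set.image_image Subtype.val,
      Set.preimage_image_eq _ Subtype.val_injective]
  iUnion_image := by
    ext x
    rw [Set.mem_iUnion]
    constructor
    · rintro ⟨j, hj⟩
      rw [(D j).proj_image_V hΦ] at hj
      obtain ⟨z, -, rfl⟩ := hj
      exact (totalProj B z).2
    · intro hx
      obtain ⟨t, z, hz, hzx⟩ := hD ⟨x, hx⟩
      refine ⟨⟨t, z, hz⟩, ?_⟩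
      rw [(D t).proj_image_V hΦ]
      exact ⟨z, hz, congrArg Subtype.val hzx⟩

theorem isClosedCover_localModelCover : (localModelCover hΦ D hD).IsClosedCover :=
  fun j => (D j).isClosed

/-- The new objects map to the old ones by local diffeomorphisms, `a` from the submanifolds and `b`
from the slices. By `obj_toObjects` these carry the inclusion to `Φ.obj`, so `Φ` can be pulled back.
-/
theorem exists_obj_eq_inclusion_localModelCover
    (h : (localModelCover hΦ D hD).InducesCharts) :
    ∃ Ψ : GroupoidEmbedding k n (totalProj ((localModelCover hΦ D hD).inducedAtlas h))
      (totalProj fun t => (D t).chart), Ψ.obj = (localModelCover hΦ D hD).inclusion h := by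
  let C := localModelCover hΦ D hD
  let a : Objects (C.inducedAtlas h) → Objects B := fun p => (D p.1).toObjects p.2
  let b : Objects (fun t => (D t).chart) → Objects A := fun p => (D p.1).chartIncl p.2
  have ha : IsLocalDiffeomorph (𝓡 k) (𝓡 k) ∞ a :=
    isLocalDiffeomorph_sigma_desc (Q := fun j => (C.inducedAtlas h j).carrier)
      fun j => (D j).isLocalDiffeomorph_toObjects
  have hb : IsLocalDiffeomorph (𝓡 n) (𝓡 n) ∞ b :=
    isLocalDiffeomorph_sigma_desc (Q := fun t => (D t).chart.carrier)
      fun t => (D t).isLocalDiffeomorph_chartIncl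
  have hba : ∀ p, b (C.inclusion h p) = Φ.obj (a p) := fun p => ((D p.1).obj_toObjects p.2).symm
  have hemb : Topology.IsEmbedding (C.inclusion h) :=
    (Topology.isEmbedding_sigmaMap (f₁ := (Subtype.val : C.J → T))
      (σ := fun j => (C.inducedAtlas h j).carrier) (τ := fun t => (D t).chart.carrier)
      (f₂ := fun j => fun p : C.V j => p.1) Subtype.val_injective).2 fun j => .subtypeVal
  refine Φ.exists_obj_eq ha (fun p => ?_) hb (fun _ => rfl)
    ⟨isImmersion_of_isLocalDiffeomorph_comp ?_ hb hemb.continuous, hemb⟩ hba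
  · refine Subtype.ext ?_
    rw [← hΦ, ← hba]
    rfl
  · rw [show b ∘ C.inclusion h = Φ.obj ∘ a from funext hba]
    exact isImmersion_comp_isLocalDiffeomorph Φ.obj_isSmoothEmbedding.isImmersion ha

end Refinement

/-! ### Countable refinement of the atlas -/

namespace SuborbifoldCover

variable {n k : ℕ} {X : Type u} [TopologicalSpace X] {Y : Set X} {ι : Type}
  {A : ι → OrbifoldChart.{u, v} n X}

/-- A groupoid embedding over the identity of `X` can be replaced by an inclusion, for a closed
suborbifold cover with respect to another atlas. -/
theorem exists_isClosedCover_obj_eq_inclusion [SecondCountableTopology X]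
    {𝒜 : Set (OrbifoldChart.{u, v} n X)} (h𝒜 : IsMaximalAtlas 𝒜) (hA : IsCountableSubatlas A 𝒜)
    (C : SuborbifoldCover k A Y) (h : C.InducesCharts)
    (Φ : GroupoidEmbedding k n (totalProj (C.inducedAtlas h)) (totalProj A))
    (hΦ : ∀ p, totalProj A (Φ.obj p) = ((totalProj (C.inducedAtlas h) p : Y) : X)) :
    ∃ (ι' : Type) (A' : ι' → OrbifoldChart.{u, v} n X), IsCountableSubatlas A' 𝒜 ∧
      ∃ (C' : SuborbifoldCover k A' Y) (hC' : C'.IsClosedCover)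
        (Ψ : GroupoidEmbedding k n (totalProj (C'.inducedAtlas hC'.inducesCharts)) (totalProj A')),
        Ψ.obj = C'.inclusion hC'.inducesCharts := by
  have hsurj : ∀ y : Y, ∃ p, totalProj (C.inducedAtlas h) p = y := by
    rintro ⟨y, hy⟩
    obtain ⟨j, p, hp, hpy⟩ := Set.mem_iUnion.1 (C.iUnion_image.symm.subset hy)
    exact ⟨⟨j, (⟨p, hp⟩ : C.V j)⟩, Subtype.ext hpy⟩
  choose p hp using hsurj
  choose D hD using exists_localModel Φ hΦ
  -- Local models have open images in the second countable space `Y`, so countably many of them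
  -- cover it.
  obtain ⟨T, hT, hTu⟩ := TopologicalSpace.isOpen_iUnion_countable
    (fun y : Y => totalProj (C.inducedAtlas h) '' (D (p y)).S)
    fun y => isOpenMap_totalProj _ (D (p y)).isOpen
  have : Countable T := hT
  have : Countable (Shrink.{0} T) := (equivShrink.{0} T).symm.injective.countable
  have := hA.countable
  -- The slices alone need only cover `Y`; adjoining all the original charts, with empty `S`, makes
  -- the family an atlas of `X`. `Shrink` brings the countable index set down to `Type`.
  let D' : Shrink.{0} T ⊕ ι → LocalModel A Φ.obj :=
    Sum.elim (fun t => D (p ((equivShrink.{0} T).symm t))) (LocalModel.top A Φ.obj)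
  have hD' : ∀ y : Y, ∃ t, ∃ z ∈ (D' t).S, totalProj (C.inducedAtlas h) z = y := by
    intro y
    have hy : y ∈ ⋃ y : Y, totalProj (C.inducedAtlas h) '' (D (p y)).S :=
      Set.mem_iUnion.2 ⟨y, p y, hD _, hp y⟩
    rw [← hTu] at hy
    obtain ⟨y', hy', z, hz, hzy⟩ := Set.mem_iUnion₂.1 hy
    refine ⟨.inl (equivShrink.{0} T ⟨y', hy'⟩), z, ?_, hzy⟩
    change z ∈ (D (p ((equivShrink.{0} T).symm (equivShrink.{0} T ⟨y', hy'⟩)))).S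
    rwa [Equiv.symm_apply_apply]
  have hmem : ∀ t, (D' t).chart ∈ 𝒜 := fun t => h𝒜.restrict_mem (hA.mem _) _
  refine ⟨_, fun t => (D' t).chart, ⟨inferInstance, hmem, ?_, fun x => ?_⟩,
    localModelCover hΦ D' hD', isClosedCover_localModelCover hΦ D' hD',
    exists_obj_eq_inclusion_localModelCover hΦ D' hD' _⟩
  · rintro _ ⟨t, rfl⟩ _ ⟨t', rfl⟩
    exact h𝒜.prop.compatible _ (hmem t) _ (hmem t')
  · obtain ⟨_, ⟨i, rfl⟩, hx⟩ := hA.isAtlas.exists_mem x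
    obtain ⟨q, rfl⟩ := (A i).exists_proj_eq hx
    exact ⟨_, ⟨.inr i, rfl⟩, q, trivial, rfl⟩

theorem totalProj_inclusion {C : SuborbifoldCover k A Y} (h : C.InducesCharts)
    (p : Objects (C.inducedAtlas h)) :
    totalProj A (C.inclusion h p) = ((totalProj (C.inducedAtlas h) p : Y) : X) := rfl

theorem isStrong_of_obj_eq_inclusion {C : SuborbifoldCover k A Y} (hC : C.IsClosedCover)
    (Φ : GroupoidEmbedding k n (totalProj (C.inducedAtlas hC.inducesCharts)) (totalProj A))
    (hΦ : Φ.obj = C.inclusion hC.inducesCharts) : C.IsStrong :=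
  ⟨hC, Φ, fun o => Quotient.inductionOn o fun p => by
    change totalProj A (Φ.obj p) = _
    rw [hΦ]
    rfl⟩

end SuborbifoldCover

end Orb

end

/-! ### The equivalence -/

theorem mainTheorem8 {n : ℕ} {X : Type u} [TopologicalSpace X] [T2Space X]
    [SecondCountableTopology X] (𝒜 : Set (Orb.OrbifoldChart.{u, v} n X))
    (h𝒜 : Orb.IsMaximalAtlas 𝒜) (k : ℕ) (Y : Set X) :
    (Orb.IsStrongSuborbifold k 𝒜 Y ↔
      ∃ (ι : Type) (A : ι → Orb.OrbifoldChart.{u, v} n X), Orb.IsCountableSubatlas A 𝒜 ∧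
        ∃ (C : Orb.SuborbifoldCover k A Y) (hC : C.InducesCharts)
          (Φ : Orb.GroupoidEmbedding k n
            (Orb.totalProj (C.inducedAtlas hC)) (Orb.totalProj A)),
          Φ.obj = C.inclusion hC) ∧
    (Orb.IsStrongSuborbifold k 𝒜 Y ↔
      ∃ (ι : Type) (A : ι → Orb.OrbifoldChart.{u, v} n X), Orb.IsCountableSubatlas A 𝒜 ∧
        ∃ (C : Orb.SuborbifoldCover k A Y) (hC : C.IsClosedCover)
          (Φ : Orb.GroupoidEmbedding k n
            (Orb.totalProj (C.inducedAtlas hC.inducesCharts)) (Orb.totalProj A)),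
          Φ.obj = C.inclusion hC.inducesCharts) := by
  refine ⟨⟨?_, ?_⟩, ⟨?_, ?_⟩⟩
  · rintro ⟨ι, A, hA, C, hC, Φ, hΦ⟩
    obtain ⟨ι', A', hA', C', hC', Ψ, hΨ⟩ := C.exists_isClosedCover_obj_eq_inclusion h𝒜 hA
      -- The identity `ε ∘ |Φ| = ε`, evaluated at the orbit of `p`, says that `Φ.obj` covers the
      -- identity of `X`.
      hC.inducesCharts Φ fun p => hΦ (Quotient.mk _ p)
    exact ⟨ι', A', hA', C', hC'.inducesCharts, Ψ, hΨ⟩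
  · rintro ⟨ι, A, hA, C, hC, Φ, hΦ⟩
    -- The given cover may fail to be closed; the refinement replaces it by a closed one.
    obtain ⟨ι', A', hA', C', hC', Ψ, hΨ⟩ := C.exists_isClosedCover_obj_eq_inclusion h𝒜 hA
      hC Φ fun p => by rw [hΦ, Orb.SuborbifoldCover.totalProj_inclusion]
    exact ⟨ι', A', hA', C', Orb.SuborbifoldCover.isStrong_of_obj_eq_inclusion hC' Ψ hΨ⟩
  · rintro ⟨ι, A, hA, C, hC, Φ, hΦ⟩
    exact C.exists_isClosedCover_obj_eq_inclusion h𝒜 hA hC.inducesCharts Φ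
      fun p => hΦ (Quotient.mk _ p)
  · rintro ⟨ι, A, hA, C, hC, Φ, hΦ⟩
    exact ⟨ι, A, hA, C, Orb.SuborbifoldCover.isStrong_of_obj_eq_inclusion hC Φ hΦ⟩
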